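/- Let $v_1,v_2\in\mathbb R^2$ be linearly independent and let $\mathbb T^2=\mathbb R^2/\langle v_1,v_2\rangle$, where $\langle v_1,v_2\rangle=\{a v_1+b v_2: a,b\in\mathbb Z\}$, be the corresponding flat torus, with projection $\pi:\mathbb R^2\to\mathbb T^2$. Let $\Omega\subset\mathbb T^2$ be a nonempty connected open set with $C^1$ boundary ($\Omega$ lying locally on one side of $\partial\Omega$), and let $\nu$ be the outward unit normal along $\partial\Omega$. Let $f$ be a real function of class $C^1$ on $[0,\infty)$, let $\alpha\in\mathbb R$, and suppose that there is a function $u\in C^2(\overline\Omega)\cap C^3(\Omega)$ with $$\Delta u+f(u)=0\ \text{ in }\Omega,\qquad u>0\ \text{ in }\Omega,\qquad u=0\ \text{ on }\partial\Omega,\qquad \langle\nabla u,\nu\rangle=\alpha\ \text{ on }\partial\Omega,$$ and $$2\max_{x\in\overline\Omega}\int_0^{u(x)}f(s)\,ds<\alpha^2 .$$ Then each connected component $K$ of $\mathbb T^2\setminus\Omega$ is strictly convex, in the following sense: there is a compact strictly convex set $C\subset\mathbb R^2$, whose boundary is of class $C^2$ with positive curvature, such that $\pi$ is injective on $C$ and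 $\pi(C)=K$. -/

import Mathlib

open scoped RealInnerProductSpace Topology

noncomputable section

/-- The Euclidean plane. -/
abbrev Plane : Type := EuclideanSpace ℝ (Fin 2)

/-- The lattice `⟨v₁, v₂⟩ = {a v₁ + b v₂ : a, b ∈ ℤ}`. -/
abbrev planeLattice (v₁ v₂ : Plane) : AddSubgroup Plane := AddSubgroup.closure {v₁, v₂}

/-- The flat torus `ℝ² / ⟨v₁, v₂⟩`, with the quotient topology. -/
abbrev FlatTorus (v₁ v₂ : Plane) : Type := Plane ⧸ planeLattice v₁ v₂

/-- The universal covering `ℝ² → ℝ² / ⟨v₁, v₂⟩`, a local isometry. -/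
def torusProj (v₁ v₂ : Plane) (x : Plane) : FlatTorus v₁ v₂ := QuotientAddGroup.mk x

/-- `ν` is the outward unit normal of the open set `D ⊆ ℝ²` at the boundary point `p`: near `p`,
the set `D` is the sublevel set `{φ < 0}` of a `C¹` function `φ` with `φ p = 0`, `∇φ p ≠ 0`,
and `ν = ∇φ p / |∇φ p|`. -/
def IsOutwardUnitNormal (D : Set Plane) (p ν : Plane) : Prop :=
  ∃ φ : Plane → ℝ, ContDiffAt ℝ 1 φ p ∧ φ p = 0 ∧ gradient φ p ≠ 0 ∧
    (∀ᶠ y in 𝓝 p, y ∈ D ↔ φ y < 0) ∧ ν = ‖gradient φ p‖⁻¹ • gradient φ p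

/-- The boundary of `D ⊆ ℝ²` is a `C¹` curve with `D` locally on one side of it, so that there is
an outward unit normal at each boundary point. -/
def HasC1Boundary (D : Set Plane) : Prop :=
  ∀ p ∈ frontier D, ∃ ν, IsOutwardUnitNormal D p ν

/-- `u` (regarded on the closure of `Ω ⊆ ℝ² / ⟨v₁, v₂⟩`) is of class `C²(closure Ω) ∩ C³(Ω)` and
solves the overdetermined problem `Δu + f(u) = 0`, `u > 0` in `Ω`, `u = 0`, `⟨∇u, ν⟩ = α` on `∂Ω`,
where `ν` is the outward unit normal. Differentiation on the flat torus is differentiation of the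
lift `u ∘ π` to the plane, and the gradient at boundary points is the one relative to the
closure. -/
structure IsOverdeterminedSolution {v₁ v₂ : Plane} (Ω : Set (FlatTorus v₁ v₂))
    (f : ℝ → ℝ) (α : ℝ) (u : FlatTorus v₁ v₂ → ℝ) : Prop where
  contDiffOn_closure :
    ContDiffOn ℝ 2 (u ∘ torusProj v₁ v₂) (torusProj v₁ v₂ ⁻¹' closure Ω)
  contDiffOn_interior :
    ContDiffOn ℝ 3 (u ∘ torusProj v₁ v₂) (torusProj v₁ v₂ ⁻¹' Ω)
  equation : ∀ x : Plane, torusProj v₁ v₂ x ∈ Ω →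
    Laplacian.laplacian (u ∘ torusProj v₁ v₂) x + f (u (torusProj v₁ v₂ x)) = 0
  pos : ∀ q ∈ Ω, 0 < u q
  dirichlet : ∀ q ∈ frontier Ω, u q = 0
  neumann : ∀ x : Plane, torusProj v₁ v₂ x ∈ frontier Ω →
    ∀ ν : Plane, IsOutwardUnitNormal (torusProj v₁ v₂ ⁻¹' Ω) x ν →
      ⟪gradientWithin (u ∘ torusProj v₁ v₂) (torusProj v₁ v₂ ⁻¹' closure Ω) x, ν⟫ = α

/-- Near its boundary point `p`, the set `C ⊆ ℝ²` is bounded by a `C²` curve whose curvature at `p`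
is positive (with the sign that is positive for disks): near `p`, `C = {φ ≤ 0}` with `φ` of class
`C²`, `φ p = 0`, `∇φ p ≠ 0`, and the curvature `D²φ(t, t) / (|∇φ| |t|²)` in the tangent direction
`t` is positive. -/
def HasPositiveBoundaryCurvatureAt (C : Set Plane) (p : Plane) : Prop :=
  ∃ φ : Plane → ℝ, ContDiffAt ℝ 2 φ p ∧ φ p = 0 ∧ gradient φ p ≠ 0 ∧
    (∀ᶠ y in 𝓝 p, y ∈ C ↔ φ y ≤ 0) ∧
    ∀ t : Plane, t ≠ 0 → ⟪gradient φ p, t⟫ = 0 → 0 < iteratedFDeriv ℝ 2 φ p ![t, t]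

/-- A subset `K` of the flat torus is a strictly convex region: it is the one-to-one (hence
isometric) projection of a compact strictly convex set `C` of the plane, with boundary of class `C²`
and of positive curvature. -/
def IsStrictlyConvexRegion {v₁ v₂ : Plane} (K : Set (FlatTorus v₁ v₂)) : Prop :=
  ∃ C : Set Plane, IsCompact C ∧ StrictConvex ℝ C ∧
    (∀ p ∈ frontier C, HasPositiveBoundaryCurvatureAt C p) ∧
    Set.InjOn (torusProj v₁ v₂) C ∧ torusProj v₁ v₂ '' C = K

end

/-! The proof rests on the `P`-function `P = |∇u|² + 2F(u)`, where `F' = f` and `F(0) = 0`. In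
dimension two it satisfies `|∇u|² ΔP = |∇P|² - 2f(u)⟨∇u, ∇P⟩`, so wherever `∇u ≠ 0` it obeys `ΔP ≥
-N|∇P|` locally, and the strong maximum principle and Hopf's lemma apply
(`norm_sq_mul_laplacian_pFunction`, `hopf_boundary_point_lemma`).

On the boundary `P = α²`, while at a critical point of `u` the hypothesis on `F` gives `P = 2F(u) <
α²`. If `P` reached `α²` inside `Ω`, its maximum would be attained in `Ω` at a noncritical point. It
would then spread to all of `Ω`, including an interior maximum of `u`, where `∇u = 0`: a
contradiction. Hence `P < α²` in `Ω` (`pFunction_lt`).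

Hopf's lemma now gives `∂P/∂ν > 0` on the boundary. With `Ω` locally below a graph `y = g(x)`
tangent to the first axis, the equation and the boundary conditions give `∂P/∂ν = -2α u_ττ = 2α²
g''(0)`. So `g'' > 0`: the complement of `Ω` is locally convex with positively curved boundary
(`exists_isSubgraphNear_deriv_pos`).

The rest is global. Compactness of the torus makes the local convexity of the lifted complement
uniform, and the Tietze–Nakajima theorem makes its components convex; positive curvature makes them
strictly convex. A boundary point `p` of a component invariant under a period `ℓ ≠ 0` would be the
midpoint of `p ± ℓ`, which strict convexity forbids. So components embed in the torus, and an
unbounded one would contain a long thick strip, too large to embed. -/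

noncomputable section

/-! ### Second derivative test along lines. -/

section SecondDerivative

variable {E : Type*} [NormedAddCommGroup E] [NormedSpace ℝ E]

theorem hasDerivAt_comp_line {w : E → ℝ} {x e : E} {t : ℝ}
    (hw : DifferentiableAt ℝ w (x + t • e)) :
    HasDerivAt (fun s : ℝ => w (x + s • e)) (fderiv ℝ w (x + t • e) e) t := by
  have h1 : HasDerivAt (fun s : ℝ => x + s • e) e t := by
    simpa using ((hasDerivAt_id t).smul_const e).const_add x
  exact hw.hasFDerivAt.comp_hasDerivAt t h1

theorem tendsto_line (x e : E) : Filter.Tendsto (fun s : ℝ => x + s • e) (𝓝 0) (𝓝 x) := by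
  have : Continuous (fun s : ℝ => x + s • e) := by fun_prop
  simpa using this.tendsto 0

theorem ContDiffAt.differentiableAt_fderiv {F : Type*} [NormedAddCommGroup F] [NormedSpace ℝ F]
    {w : E → F} {x : E} (hw : ContDiffAt ℝ 2 w x) :
    DifferentiableAt ℝ (fderiv ℝ w) x :=
  (hw.fderiv_right (m := 1) (by norm_num)).differentiableAt (by norm_num)

/-- Second derivative test along a line. -/
theorem ContDiffAt.fderiv_fderiv_nonpos_of_isLocalMax_line {w : E → ℝ} {x e : E}
    (hw : ContDiffAt ℝ 2 w x) (h : IsLocalMax (fun t : ℝ => w (x + t • e)) 0) :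
    fderiv ℝ w x e = 0 ∧ fderiv ℝ (fderiv ℝ w) x e e ≤ 0 := by
  set φ : ℝ → ℝ := fun t => w (x + t • e) with hφ
  have hev : ∀ᶠ y in 𝓝 x, DifferentiableAt ℝ w y := by
    filter_upwards [hw.eventually (by simp)] with y hy using hy.differentiableAt (by norm_num)
  have hd : ∀ᶠ t in 𝓝 (0 : ℝ), HasDerivAt φ (fderiv ℝ w (x + t • e) e) t := by
    filter_upwards [(tendsto_line x e).eventually hev] with t ht using hasDerivAt_comp_line ht
  have hd0 : HasDerivAt φ (fderiv ℝ w x e) 0 := by simpa using hd.self_of_nhds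
  have hzero : fderiv ℝ w x e = 0 := by rw [← hd0.deriv]; exact h.deriv_eq_zero
  refine ⟨hzero, ?_⟩
  have hdd : HasDerivAt (fun t : ℝ => fderiv ℝ w (x + t • e) e)
      (fderiv ℝ (fderiv ℝ w) x e e) 0 := by
    have h1 : HasDerivAt (fun s : ℝ => x + s • e) e 0 := by
      simpa using ((hasDerivAt_id (0 : ℝ)).smul_const e).const_add x
    have h2 : HasFDerivAt (fderiv ℝ w) (fderiv ℝ (fderiv ℝ w) x) (x + (0 : ℝ) • e) := by
      simpa using hw.differentiableAt_fderiv.hasFDerivAt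
    have h3 := h2.comp_hasDerivAt (0 : ℝ) h1
    simpa using h3.clm_apply (hasDerivAt_const (0 : ℝ) e)
  have hde : deriv φ =ᶠ[𝓝 0] fun t : ℝ => fderiv ℝ w (x + t • e) e := by
    filter_upwards [hd] with t ht using ht.deriv
  by_contra hpos
  push Not at hpos
  have hdd' : deriv (deriv φ) 0 = fderiv ℝ (fderiv ℝ w) x e e := by
    rw [hde.deriv_eq, hdd.deriv]
  -- A positive second derivative would make `0` a local minimum as well as a local maximum, so `φ`
  -- would be locally constant and its second derivative zero.
  have hmin : IsLocalMin φ 0 := by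
    refine isLocalMin_of_deriv_deriv_pos (by rw [hdd']; exact hpos) ?_ hd0.continuousAt
    rw [hd0.deriv, hzero]
  have hconst : φ =ᶠ[𝓝 0] fun _ => φ 0 := by
    filter_upwards [h, hmin] with t h1 h2 using le_antisymm h1 h2
  have : deriv (deriv φ) 0 = 0 := by
    rw [hconst.deriv.deriv_eq]; simp
  linarith

end SecondDerivative

/-! ### The Laplacian, the radial barrier and Hopf's lemma. -/

section Laplacian

theorem laplacian_eq_sum_orthonormalBasis (b : OrthonormalBasis (Fin 2) ℝ Plane)
    (w : Plane → ℝ) (x : Plane) :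
    Laplacian.laplacian w x =
      fderiv ℝ (fderiv ℝ w) x (b 0) (b 0) + fderiv ℝ (fderiv ℝ w) x (b 1) (b 1) := by
  rw [InnerProductSpace.laplacian_eq_iteratedFDeriv_orthonormalBasis w b]
  simp [Fin.sum_univ_two, iteratedFDeriv_two_apply]

theorem laplacian_nonpos_of_isLocalMax {w : Plane → ℝ} {x : Plane} (hw : ContDiffAt ℝ 2 w x)
    (h : IsLocalMax w x) : Laplacian.laplacian w x ≤ 0 := by
  have key : ∀ e : Plane, fderiv ℝ (fderiv ℝ w) x e e ≤ 0 := fun e => by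
    refine (hw.fderiv_fderiv_nonpos_of_isLocalMax_line (e := e) ?_).2
    have := (tendsto_line x e).eventually h
    simpa [IsLocalMax, IsMaxFilter] using this
  rw [laplacian_eq_sum_orthonormalBasis (EuclideanSpace.basisFun (Fin 2) ℝ)]
  exact add_nonpos (key _) (key _)

/-- The radial barrier used in the Hopf boundary point lemma. -/
def hopfBarrier (k : ℝ) (c x : Plane) : ℝ := Real.exp (-k * ‖x - c‖ ^ 2)

theorem contDiff_hopfBarrier (k : ℝ) (c : Plane) : ContDiff ℝ 2 (hopfBarrier k c) := by
  unfold hopfBarrier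
  exact Real.contDiff_exp.comp (contDiff_const.mul ((contDiff_id.sub contDiff_const).norm_sq ℝ))

theorem hasFDerivAt_hopfBarrier (k : ℝ) (c x : Plane) :
    HasFDerivAt (hopfBarrier k c)
      ((-(2 * k) * hopfBarrier k c x) • innerSL ℝ (x - c)) x := by
  have h1 : HasFDerivAt (fun y : Plane => ‖y - c‖ ^ 2) (2 • innerSL ℝ (x - c)) x := by
    simpa using ((hasFDerivAt_id x).sub_const c).norm_sq
  refine (h1.const_mul (-k)).exp.congr_fderiv ?_
  ext v
  simp [hopfBarrier]
  ring

theorem fderiv_hopfBarrier (k : ℝ) (c x : Plane) :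
    fderiv ℝ (hopfBarrier k c) x = (-(2 * k) * hopfBarrier k c x) • innerSL ℝ (x - c) :=
  (hasFDerivAt_hopfBarrier k c x).fderiv

theorem norm_fderiv_hopfBarrier {k : ℝ} (hk : 0 ≤ k) (c x : Plane) :
    ‖fderiv ℝ (hopfBarrier k c) x‖ = 2 * k * hopfBarrier k c x * ‖x - c‖ := by
  rw [fderiv_hopfBarrier, norm_smul, innerSL_apply_norm]
  have : 0 < hopfBarrier k c x := Real.exp_pos _
  rw [Real.norm_eq_abs, neg_mul, abs_neg, abs_of_nonneg (by positivity)]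

theorem fderiv_fderiv_hopfBarrier (k : ℝ) (c x e : Plane) :
    fderiv ℝ (fderiv ℝ (hopfBarrier k c)) x e e =
      hopfBarrier k c x * (4 * k ^ 2 * ⟪x - c, e⟫ ^ 2 - 2 * k * ‖e‖ ^ 2) := by
  have h0 : fderiv ℝ (hopfBarrier k c) =
      fun y => (-(2 * k) * hopfBarrier k c y) • innerSL ℝ (y - c) := by
    ext1 y; exact fderiv_hopfBarrier k c y
  have h1 : HasFDerivAt (fun y : Plane => innerSL ℝ (y - c)) (innerSL ℝ : Plane →L[ℝ] _) x := by
    have h2 : HasFDerivAt (fun y : Plane => y - c) (ContinuousLinearMap.id ℝ Plane) x :=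
      (hasFDerivAt_id x).sub_const c
    exact (innerSL ℝ : Plane →L[ℝ] (Plane →L[ℝ] ℝ)).hasFDerivAt.comp x h2
  have h3 := ((hasFDerivAt_hopfBarrier k c x).const_mul (-(2 * k))).smul h1
  rw [h0]
  erw [h3.fderiv]
  have h4 : innerSL ℝ e e = ‖e‖ ^ 2 := real_inner_self_eq_norm_sq e
  have h5 : innerSL ℝ (x - c) e = ⟪x - c, e⟫ := rfl
  simp only [add_apply, smul_apply,
    ContinuousLinearMap.smulRight_apply, h4, h5, smul_eq_mul]
  ring

theorem laplacian_hopfBarrier (k : ℝ) (c x : Plane) :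
    Laplacian.laplacian (hopfBarrier k c) x =
      hopfBarrier k c x * (4 * k ^ 2 * ‖x - c‖ ^ 2 - 4 * k) := by
  have hb := (EuclideanSpace.basisFun (Fin 2) ℝ).sum_sq_norm_inner_left (x - c)
  rw [Fin.sum_univ_two] at hb
  simp only [Real.norm_eq_abs, sq_abs] at hb
  rw [laplacian_eq_sum_orthonormalBasis (EuclideanSpace.basisFun (Fin 2) ℝ),
    fderiv_fderiv_hopfBarrier, fderiv_fderiv_hopfBarrier, ← hb]
  simp only [OrthonormalBasis.norm_eq_one]
  ring

end Laplacian

/-- **Hopf's boundary point lemma** on a disk, in a quantitative form that does not mention the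
normal derivative. -/
theorem hopf_boundary_point_lemma {w : Plane → ℝ} {c p : Plane} {N : ℝ} (hcp : p ≠ c)
    (hcont : ContinuousOn w (Metric.closedBall c (dist p c)))
    (hC2 : ∀ x ∈ Metric.ball c (dist p c), ContDiffAt ℝ 2 w x)
    (hlap : ∀ x ∈ Metric.ball c (dist p c), -N * ‖fderiv ℝ w x‖ ≤ Laplacian.laplacian w x)
    (hlt : ∀ x ∈ Metric.ball c (dist p c), w x < w p) :
    ∃ m > 0, ∀ t ∈ Set.Icc (0 : ℝ) (1 / 2), w (p + t • (c - p)) ≤ w p - m * t := by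
  set R := dist p c with hRdef
  have hR : 0 < R := dist_pos.2 hcp
  have hle : ∀ x ∈ Metric.closedBall c R, w x ≤ w p := by
    intro x hx
    rw [← closure_ball c hR.ne'] at hx hcont
    exact le_on_closure (fun y hy => (hlt y hy).le) hcont continuousOn_const hx
  -- Chosen so that `2kr² - 2 - Nr > 0` for `R/2 ≤ r ≤ R`: this makes the barrier a strict
  -- subsolution on the annulus.
  set k : ℝ := (6 + 2 * |N| * R) / R ^ 2 with hk
  have hkpos : 0 < k := by positivity
  have hkR : k * R ^ 2 = 6 + 2 * |N| * R := by rw [hk]; field_simp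
  have hv1 : ∀ x, hopfBarrier k c x ≤ 1 := fun x => by
    refine Real.exp_le_one_iff.2 ?_
    have := sq_nonneg ‖x - c‖
    nlinarith
  -- The gap `δ` on the inner sphere pays for adding `δ` times a barrier that is at most `1`.
  obtain ⟨δ, hδ, hδw⟩ : ∃ δ > 0, ∀ x ∈ Metric.sphere c (R / 2), w x ≤ w p - δ := by
    have hsub : Metric.sphere c (R / 2) ⊆ Metric.ball c R := fun x hx => by
      rw [Metric.mem_sphere] at hx; rw [Metric.mem_ball]; linarith
    obtain ⟨z, hz, hmax⟩ := (isCompact_sphere c (R / 2)).exists_isMaxOn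
      (NormedSpace.sphere_nonempty.2 (by positivity))
      (hcont.mono (hsub.trans Metric.ball_subset_closedBall))
    refine ⟨w p - w z, sub_pos.2 (hlt z (hsub hz)), fun x hx => ?_⟩
    have : w x ≤ w z := hmax hx
    linarith
  set A : Set Plane := Metric.closedBall c R ∩ {x | R / 2 ≤ dist x c} with hA
  have hAc : IsCompact A := (isCompact_closedBall c R).inter_right
    (isClosed_le continuous_const (by fun_prop))
  set W : Plane → ℝ := w + δ • hopfBarrier k c with hW
  have hWx : ∀ x, W x = w x + δ * hopfBarrier k c x := fun x => by simp [hW]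
  have hWA : ∀ x ∈ A, W x ≤ w p + δ * Real.exp (-k * R ^ 2) := by
    have hpA : p ∈ A := ⟨by simp [hRdef], by simp only [Set.mem_ofPred_eq]; linarith⟩
    have hWc : ContinuousOn W A :=
      (hcont.mono Set.inter_subset_left).add
        ((contDiff_hopfBarrier k c).continuous.const_smul δ).continuousOn
    obtain ⟨z, hz, hmax⟩ := hAc.exists_isMaxOn ⟨p, hpA⟩ hWc
    intro x hx
    refine (hmax hx).trans ?_
    change W z ≤ _
    rw [hWx]
    have hzR : dist z c ≤ R := hz.1
    have hzR2 : R / 2 ≤ dist z c := hz.2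
    rcases hzR.eq_or_lt with h1 | h1
    · have : hopfBarrier k c z = Real.exp (-k * R ^ 2) := by
        rw [hopfBarrier, ← dist_eq_norm, h1]
      rw [this]
      have := hle z hz.1
      linarith
    rcases hzR2.eq_or_lt with h2 | h2
    · have h3 := hδw z h2.symm
      have h4 := mul_le_mul_of_nonneg_left (hv1 z) hδ.le
      have h5 : 0 < δ * Real.exp (-k * R ^ 2) := by positivity
      linarith
    exfalso
    have hzb : z ∈ Metric.ball c R := h1
    have hnhds : A ∈ 𝓝 z := by
      refine Filter.inter_mem (Metric.closedBall_mem_nhds_of_mem hzb) ?_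
      have : IsOpen {x : Plane | R / 2 < dist x c} :=
        isOpen_lt continuous_const (by fun_prop)
      exact Filter.mem_of_superset (this.mem_nhds h2) fun y hy => by
        rw [Set.mem_ofPred_eq] at hy ⊢; exact hy.le
    have hloc : IsLocalMax W z := Filter.mem_of_superset hnhds hmax
    have hv2 : ContDiffAt ℝ 2 (hopfBarrier k c) z := (contDiff_hopfBarrier k c).contDiffAt
    have hwz := hC2 z hzb
    have hlapW := laplacian_nonpos_of_isLocalMax (hwz.add (hv2.const_smul δ)) hloc
    erw [ContDiffAt.laplacian_add hwz (hv2.const_smul δ),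
      InnerProductSpace.laplacian_smul δ hv2] at hlapW
    -- At an interior maximum of `W` the gradient of `w` is controlled by that of the barrier, so
    -- the bound on `Δw` contradicts `ΔW ≤ 0`.
    have hgrad : fderiv ℝ w z = -(δ • fderiv ℝ (hopfBarrier k c) z) := by
      have h5 := hloc.fderiv_eq_zero
      have h6 : HasFDerivAt W (fderiv ℝ w z + δ • fderiv ℝ (hopfBarrier k c) z) z :=
        (hwz.differentiableAt (by norm_num)).hasFDerivAt.add
          ((hv2.differentiableAt (by norm_num)).hasFDerivAt.const_smul δ)
      rw [h6.fderiv] at h5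
      exact eq_neg_of_add_eq_zero_left h5
    have h6 := hlap z hzb
    rw [hgrad, norm_neg, norm_smul, Real.norm_of_nonneg hδ.le,
      norm_fderiv_hopfBarrier hkpos.le] at h6
    rw [laplacian_hopfBarrier, smul_eq_mul] at hlapW
    rw [dist_eq_norm] at h1 h2
    set r := ‖z - c‖
    have hvpos : 0 < hopfBarrier k c z := Real.exp_pos _
    have h7 : 4 * k ^ 2 * r ^ 2 - 4 * k - N * (2 * k * r) ≤ 0 := by
      have : (δ * hopfBarrier k c z) * (4 * k ^ 2 * r ^ 2 - 4 * k - N * (2 * k * r)) ≤ 0 := by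
        linarith
      exact nonpos_of_mul_nonpos_right this (by positivity)
    have h8 : 2 * (k * r ^ 2) - 2 - N * r ≤ 0 := by
      have : (2 * k) * (2 * (k * r ^ 2) - 2 - N * r) ≤ 0 := by linarith
      exact nonpos_of_mul_nonpos_right this (by positivity)
    have h9 : N * r ≤ |N| * R :=
      mul_le_mul (le_abs_self N) h1.le (by positivity) (abs_nonneg N)
    have h10 : k * (R / 2) ^ 2 ≤ k * r ^ 2 := by gcongr
    nlinarith
  refine ⟨δ * Real.exp (-k * R ^ 2) * (k * R ^ 2), by positivity, fun t ht => ?_⟩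
  obtain ⟨ht0, ht1⟩ := ht
  have hnorm : ‖p + t • (c - p) - c‖ = (1 - t) * R := by
    have : p + t • (c - p) - c = (1 - t) • (p - c) := by module
    rw [this, norm_smul, Real.norm_of_nonneg (by linarith), hRdef, dist_eq_norm]
  have hmem : p + t • (c - p) ∈ A := by
    constructor
    · rw [Metric.mem_closedBall, dist_eq_norm, hnorm]; nlinarith
    · rw [Set.mem_ofPred_eq, dist_eq_norm, hnorm]; nlinarith
  have h1 := hWA _ hmem
  rw [hWx, hopfBarrier, hnorm] at h1
  -- Linear growth of the barrier along the radius, from `1 + a ≤ exp a` and `2t - t² ≥ t`.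
  have h2 : Real.exp (-k * R ^ 2) * (1 + k * R ^ 2 * t) ≤ Real.exp (-k * ((1 - t) * R) ^ 2) := by
    have h3 : -k * ((1 - t) * R) ^ 2 = -k * R ^ 2 + k * R ^ 2 * (2 * t - t ^ 2) := by ring
    rw [h3, Real.exp_add]
    gcongr
    have h4 := Real.add_one_le_exp (k * R ^ 2 * (2 * t - t ^ 2))
    have h5 : k * R ^ 2 * t ≤ k * R ^ 2 * (2 * t - t ^ 2) := by
      gcongr
      nlinarith
    linarith
  have h6 := mul_le_mul_of_nonneg_left h2 hδ.le
  linarith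

theorem norm_sq_eq_sum_apply_sq (b : OrthonormalBasis (Fin 2) ℝ Plane) (L : Plane →L[ℝ] ℝ) :
    ‖L‖ ^ 2 = L (b 0) ^ 2 + L (b 1) ^ 2 := by
  obtain ⟨v, rfl⟩ := (InnerProductSpace.toDual ℝ Plane).surjective L
  rw [LinearIsometryEquiv.norm_map, ← b.sum_sq_norm_inner_left v, Fin.sum_univ_two]
  simp

/-! ### Second-order calculus for compositions and sums. -/

section Calculus

variable {E : Type*} [NormedAddCommGroup E] [NormedSpace ℝ E]

theorem fderiv_apply_eq {F : Type*} [NormedAddCommGroup F] [NormedSpace ℝ F]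
    {A : E → E →L[ℝ] F} {x : E} (hA : DifferentiableAt ℝ A x) (e v : E) :
    fderiv ℝ (fun y => A y e) x v = fderiv ℝ A x v e := by
  have h := hA.hasFDerivAt.clm_apply (hasFDerivAt_const e x)
  rw [h.fderiv]
  simp

theorem fderiv_fderiv_comp_scalar {a : E → ℝ} {x : E} (ha : ContDiffAt ℝ 2 a x)
    {g g' : ℝ → ℝ} {g'' : ℝ} (hg : ∀ᶠ s in 𝓝 (a x), HasDerivAt g (g' s) s)
    (hg' : HasDerivAt g' g'' (a x)) (e : E) :
    fderiv ℝ (fderiv ℝ (fun y => g (a y))) x e e =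
      g'' * fderiv ℝ a x e ^ 2 + g' (a x) * fderiv ℝ (fderiv ℝ a) x e e := by
  have hev : ∀ᶠ y in 𝓝 x, DifferentiableAt ℝ a y := by
    filter_upwards [ha.eventually (by simp)] with y hy using hy.differentiableAt (by norm_num)
  have h1 : fderiv ℝ (fun y => g (a y)) =ᶠ[𝓝 x] fun y => g' (a y) • fderiv ℝ a y := by
    filter_upwards [hev, ha.continuousAt.eventually hg] with y h2 h3
    exact (h3.comp_hasFDerivAt y h2.hasFDerivAt).fderiv
  have h2 := (hg'.comp_hasFDerivAt x hev.self_of_nhds.hasFDerivAt).smul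
    ha.differentiableAt_fderiv.hasFDerivAt
  rw [h1.fderiv_eq]
  erw [h2.fderiv]
  simp
  ring

theorem fderiv_fderiv_add {a b : E → ℝ} {x : E} (ha : ContDiffAt ℝ 2 a x)
    (hb : ContDiffAt ℝ 2 b x) :
    fderiv ℝ (fderiv ℝ (a + b)) x = fderiv ℝ (fderiv ℝ a) x + fderiv ℝ (fderiv ℝ b) x := by
  have h1 : fderiv ℝ (a + b) =ᶠ[𝓝 x] fderiv ℝ a + fderiv ℝ b := by
    filter_upwards [ha.eventually (by simp), hb.eventually (by simp)] with y h1 h2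
    exact fderiv_add (h1.differentiableAt (by norm_num)) (h2.differentiableAt (by norm_num))
  rw [h1.fderiv_eq, fderiv_add ha.differentiableAt_fderiv hb.differentiableAt_fderiv]

/-- Used for the primitive `F` of `f`, and to bootstrap the boundary graph from `C¹` to `C²`. -/
theorem contDiffAt_of_hasDerivAt {F f : ℝ → ℝ} {t : ℝ} (hf : ContDiffAt ℝ 1 f t)
    (hF : ∀ᶠ s in 𝓝 t, HasDerivAt F (f s) s) : ContDiffAt ℝ 2 F t := by
  rw [show (2 : WithTop ℕ∞) = ((1 : ℕ) : WithTop ℕ∞) + 1 by norm_num,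
    contDiffAt_succ_iff_hasFDerivAt]
  refine ⟨fun s => ContinuousLinearMap.toSpanSingleton ℝ (f s), ⟨_, hF,
    fun s hs => HasDerivAt.hasFDerivAt hs⟩, ?_⟩
  exact (ContinuousLinearMap.toSpanSingletonCLE (𝕜 := ℝ) (E := ℝ)).contDiff.contDiffAt.comp _ hf

end Calculus

/-- The `P`-function `|∇u|² + 2F(u)`, where `G` plays the role of the derivative of `u`. -/
def pFunction (F : ℝ → ℝ) (U : Plane → ℝ) (G : Plane → Plane →L[ℝ] ℝ) (x : Plane) : ℝ :=
  ‖G x‖ ^ 2 + 2 * F (U x)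

/-! ### The elliptic equation of the `P`-function. -/

section Identity

variable {F f : ℝ → ℝ} {U : Plane → ℝ} {x : Plane}

theorem contDiffAt_pFunction (hU : ContDiffAt ℝ 3 U x) (hf : ContDiffAt ℝ 1 f (U x))
    (hF : ∀ s, HasDerivAt F (f s) s) :
    ContDiffAt ℝ 2 (pFunction F U (fderiv ℝ U)) x := by
  have hF2 : ContDiffAt ℝ 2 F (U x) := contDiffAt_of_hasDerivAt hf (.of_forall hF)
  have h1 : ContDiffAt ℝ 2 (fderiv ℝ U) x := hU.fderiv_right (by norm_num)
  have h2 : pFunction F U (fderiv ℝ U) = fun y =>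
      fderiv ℝ U y (EuclideanSpace.basisFun (Fin 2) ℝ 0) ^ 2 +
      fderiv ℝ U y (EuclideanSpace.basisFun (Fin 2) ℝ 1) ^ 2 + 2 * F (U y) := by
    ext y
    rw [pFunction, norm_sq_eq_sum_apply_sq (EuclideanSpace.basisFun (Fin 2) ℝ)]
  rw [h2]
  have h3 : ContDiffAt ℝ 2 (fun y => F (U y)) x := hF2.comp x (hU.of_le (by norm_num))
  exact (((h1.clm_apply contDiffAt_const).pow 2).add
    ((h1.clm_apply contDiffAt_const).pow 2)).add (contDiffAt_const.mul h3)

/-- The elliptic equation satisfied in the plane by the `P`-function of a solution of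
`Δu + f(u) = 0`. -/
theorem norm_sq_mul_laplacian_pFunction (hU : ContDiffAt ℝ 3 U x) (hf : ContDiffAt ℝ 1 f (U x))
    (hF : ∀ s, HasDerivAt F (f s) s)
    (heq : ∀ᶠ y in 𝓝 x, Laplacian.laplacian U y + f (U y) = 0)
    (b : OrthonormalBasis (Fin 2) ℝ Plane) :
    ‖fderiv ℝ U x‖ ^ 2 * Laplacian.laplacian (pFunction F U (fderiv ℝ U)) x =
      ‖fderiv ℝ (pFunction F U (fderiv ℝ U)) x‖ ^ 2 - 2 * f (U x) *
        (fderiv ℝ U x (b 0) * fderiv ℝ (pFunction F U (fderiv ℝ U)) x (b 0) +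
          fderiv ℝ U x (b 1) * fderiv ℝ (pFunction F U (fderiv ℝ U)) x (b 1)) := by
  have hU2 : ContDiffAt ℝ 2 U x := hU.of_le (by norm_num)
  have hd1 : ContDiffAt ℝ 2 (fderiv ℝ U) x := hU.fderiv_right (by norm_num)
  have hd : ∀ i, ContDiffAt ℝ 2 (fun y => fderiv ℝ U y (b i)) x := fun i =>
    hd1.clm_apply contDiffAt_const
  set p : Plane → ℝ := fun y => fderiv ℝ U y (b 0) with hp
  set q : Plane → ℝ := fun y => fderiv ℝ U y (b 1) with hq
  have hpC : ContDiffAt ℝ 2 p x := hd 0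
  have hqC : ContDiffAt ℝ 2 q x := hd 1
  have hUe : ∀ᶠ y in 𝓝 x, ContDiffAt ℝ 3 U y := hU.eventually (by simp)
  have hpe : ∀ᶠ y in 𝓝 x, ∀ v, fderiv ℝ p y v = fderiv ℝ (fderiv ℝ U) y v (b 0) := by
    filter_upwards [hUe] with y hy v
    exact fderiv_apply_eq (hy.of_le (by norm_num) : ContDiffAt ℝ 2 U y).differentiableAt_fderiv _ _
  have hqe : ∀ᶠ y in 𝓝 x, ∀ v, fderiv ℝ q y v = fderiv ℝ (fderiv ℝ U) y v (b 1) := by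
    filter_upwards [hUe] with y hy v
    exact fderiv_apply_eq (hy.of_le (by norm_num) : ContDiffAt ℝ 2 U y).differentiableAt_fderiv _ _
  have hsymm : ∀ᶠ y in 𝓝 x, fderiv ℝ p y (b 1) = fderiv ℝ q y (b 0) := by
    filter_upwards [hUe, hpe, hqe] with y hy h1 h2
    rw [h1, h2]
    exact (hy.isSymmSndFDerivAt (by simp; norm_num)) _ _
  have heq' : ∀ᶠ y in 𝓝 x, fderiv ℝ p y (b 0) + fderiv ℝ q y (b 1) = -f (U y) := by
    filter_upwards [heq, hpe, hqe] with y h1 h2 h3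
    rw [laplacian_eq_sum_orthonormalBasis b] at h1
    rw [h2, h3]; linarith
  have hp2 := hpC.differentiableAt_fderiv
  have hq2 := hqC.differentiableAt_fderiv
  have hps : fderiv ℝ (fderiv ℝ p) x (b 1) (b 0) = fderiv ℝ (fderiv ℝ p) x (b 0) (b 1) :=
    (hpC.isSymmSndFDerivAt (by simp)) _ _
  have hqs : fderiv ℝ (fderiv ℝ q) x (b 1) (b 0) = fderiv ℝ (fderiv ℝ q) x (b 0) (b 1) :=
    (hqC.isSymmSndFDerivAt (by simp)) _ _
  -- Third derivatives of `U` are handled as second derivatives of its partials `p`, `q`;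
  -- differentiating the symmetry of the Hessian relates them.
  have hs3 : ∀ v, fderiv ℝ (fderiv ℝ p) x v (b 1) = fderiv ℝ (fderiv ℝ q) x v (b 0) := fun v => by
    rw [← fderiv_apply_eq hp2, ← fderiv_apply_eq hq2]
    have : (fun y => fderiv ℝ p y (b 1)) =ᶠ[𝓝 x] fun y => fderiv ℝ q y (b 0) := hsymm
    rw [this.fderiv_eq]
  have hfd : HasDerivAt f (deriv f (U x)) (U x) :=
    (hf.differentiableAt (by norm_num)).hasDerivAt
  -- The equation differentiated in the direction `v`.
  have he3 : ∀ v, fderiv ℝ (fderiv ℝ p) x v (b 0) + fderiv ℝ (fderiv ℝ q) x v (b 1) =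
      -(deriv f (U x) * fderiv ℝ U x v) := fun v => by
    have h1 : (fun y => fderiv ℝ p y (b 0) + fderiv ℝ q y (b 1)) =ᶠ[𝓝 x]
      fun y => -f (U y) := heq'
    have h2 : DifferentiableAt ℝ (fun y => fderiv ℝ p y (b 0)) x :=
      hp2.clm_apply (differentiableAt_const _)
    have h3 : DifferentiableAt ℝ (fun y => fderiv ℝ q y (b 1)) x :=
      hq2.clm_apply (differentiableAt_const _)
    have h4 : HasFDerivAt (fun y => -f (U y)) (-(deriv f (U x) • fderiv ℝ U x)) x :=
      (hfd.comp_hasFDerivAt x (hU2.differentiableAt (by norm_num)).hasFDerivAt).neg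
    have h5 := h1.fderiv_eq (𝕜 := ℝ)
    rw [fderiv_fun_add h2 h3] at h5
    rw [h4.fderiv] at h5
    have h6 := congrArg (fun A : Plane →L[ℝ] ℝ => A v) h5
    simp only [add_apply, fderiv_apply_eq hp2, fderiv_apply_eq hq2] at h6
    simpa using h6
  set w := pFunction F U (fderiv ℝ U) with hw
  have hwe : w = fun y => (p y ^ 2 + q y ^ 2) + 2 * F (U y) := by
    ext y
    rw [hw, pFunction, norm_sq_eq_sum_apply_sq b]
  have hpd := (hpC.differentiableAt (by norm_num)).hasFDerivAt
  have hqd := (hqC.differentiableAt (by norm_num)).hasFDerivAt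
  have hUd := (hU2.differentiableAt (by norm_num)).hasFDerivAt
  have hw1 : ∀ v, fderiv ℝ w x v = 2 * p x * fderiv ℝ p x v + 2 * q x * fderiv ℝ q x v +
      2 * f (U x) * fderiv ℝ U x v := fun v => by
    have h2 := ((hpd.pow 2).add (hqd.pow 2)).add (((hF (U x)).comp_hasFDerivAt x hUd).const_mul 2)
    rw [hwe]
    erw [h2.fderiv]
    simp
    ring
  have hw2 : ∀ v, fderiv ℝ (fderiv ℝ w) x v v =
      2 * fderiv ℝ p x v ^ 2 + 2 * p x * fderiv ℝ (fderiv ℝ p) x v v +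
      (2 * fderiv ℝ q x v ^ 2 + 2 * q x * fderiv ℝ (fderiv ℝ q) x v v) +
      (2 * deriv f (U x) * fderiv ℝ U x v ^ 2 +
        2 * f (U x) * fderiv ℝ (fderiv ℝ U) x v v) := fun v => by
    have hsq : ∀ s : ℝ, HasDerivAt (fun s : ℝ => s ^ 2) (2 * s) s := fun s => by
      simpa using hasDerivAt_pow 2 s
    have hsq' : ∀ s : ℝ, HasDerivAt (fun s : ℝ => 2 * s) 2 s := fun s => by
      simpa using (hasDerivAt_id s).const_mul 2
    have hw3 : w = ((fun y => p y ^ 2) + (fun y => q y ^ 2)) + fun y => 2 * F (U y) := hwe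
    have hFU : ContDiffAt ℝ 2 (fun y => 2 * F (U y)) x :=
      contDiffAt_const.mul ((contDiffAt_of_hasDerivAt hf (.of_forall hF)).comp x hU2)
    have hp22 : ContDiffAt ℝ 2 (fun y => p y ^ 2) x := hpC.pow 2
    have hq22 : ContDiffAt ℝ 2 (fun y => q y ^ 2) x := hqC.pow 2
    have hpq : ContDiffAt ℝ 2 ((fun y => p y ^ 2) + fun y => q y ^ 2) x := hp22.add hq22
    rw [hw3, fderiv_fderiv_add hpq hFU, fderiv_fderiv_add hp22 hq22, add_apply, add_apply, add_apply, add_apply,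
      fderiv_fderiv_comp_scalar hpC (.of_forall hsq) (hsq' _) v,
      fderiv_fderiv_comp_scalar hqC (.of_forall hsq) (hsq' _) v,
      fderiv_fderiv_comp_scalar hU2 (.of_forall fun s => (hF s).const_mul 2) (hfd.const_mul 2) v]
  have hU00 : fderiv ℝ (fderiv ℝ U) x (b 0) (b 0) = fderiv ℝ p x (b 0) :=
    (hpe.self_of_nhds _).symm
  have hU11 : fderiv ℝ (fderiv ℝ U) x (b 1) (b 1) = fderiv ℝ q x (b 1) :=
    (hqe.self_of_nhds _).symm
  have e1 := heq'.self_of_nhds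
  have e2 := hsymm.self_of_nhds
  have e3 := he3 (b 0)
  have e4 := he3 (b 1)
  have e5 := hs3 (b 0)
  have e6 := hs3 (b 1)
  rw [norm_sq_eq_sum_apply_sq b, norm_sq_eq_sum_apply_sq b, laplacian_eq_sum_orthonormalBasis b,
    hw1, hw1, hw2, hw2, hU00, hU11]
  have hp0 : fderiv ℝ U x (b 0) = p x := rfl
  have hq0 : fderiv ℝ U x (b 1) = q x := rfl
  rw [hp0] at e3 ⊢
  rw [hq0] at e4 ⊢
  rw [e6, hqs, ← e2]
  rw [← e5, ← hps]
  generalize fderiv ℝ (fderiv ℝ p) x (b 0) (b 0) = A at *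
  generalize fderiv ℝ (fderiv ℝ q) x (b 0) (b 1) = B at *
  generalize fderiv ℝ (fderiv ℝ p) x (b 1) (b 0) = C at *
  generalize fderiv ℝ (fderiv ℝ q) x (b 1) (b 1) = D at *
  generalize fderiv ℝ p x (b 0) = r at *
  generalize fderiv ℝ p x (b 1) = s at *
  generalize fderiv ℝ q x (b 1) = t at *
  -- Once `f(U)` is replaced by minus the trace of the Hessian, the second-order terms cancel
  -- identically; this is where dimension two enters. The third-order terms go by the differentiated
  -- equation.
  have hfe : f (U x) = -(r + t) := by linarith
  rw [hfe]
  linear_combination (p x ^ 2 + q x ^ 2) * (2 * p x * e3 + 2 * q x * e4)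

/-- In the identity for `|∇U|² ΔP`, drop `|∇P|² ≥ 0`, apply Cauchy–Schwarz to the cross term, and
divide by `|∇U|² > 0`. -/
theorem laplacian_pFunction_ge (hU : ContDiffAt ℝ 3 U x) (hf : ContDiffAt ℝ 1 f (U x))
    (hF : ∀ s, HasDerivAt F (f s) s)
    (heq : ∀ᶠ y in 𝓝 x, Laplacian.laplacian U y + f (U y) = 0) {N : ℝ}
    (hne : fderiv ℝ U x ≠ 0) (hN : 2 * |f (U x)| ≤ N * ‖fderiv ℝ U x‖) :
    -N * ‖fderiv ℝ (pFunction F U (fderiv ℝ U)) x‖ ≤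
      Laplacian.laplacian (pFunction F U (fderiv ℝ U)) x := by
  set w := pFunction F U (fderiv ℝ U)
  set b := EuclideanSpace.basisFun (Fin 2) ℝ
  have h := norm_sq_mul_laplacian_pFunction hU hf hF heq b
  have hcs : |fderiv ℝ U x (b 0) * fderiv ℝ w x (b 0) + fderiv ℝ U x (b 1) * fderiv ℝ w x (b 1)| ≤
      ‖fderiv ℝ U x‖ * ‖fderiv ℝ w x‖ := by
    refine abs_le_of_sq_le_sq ?_ (by positivity)
    rw [mul_pow, norm_sq_eq_sum_apply_sq b, norm_sq_eq_sum_apply_sq b]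
    nlinarith [sq_nonneg (fderiv ℝ U x (b 0) * fderiv ℝ w x (b 1) -
      fderiv ℝ U x (b 1) * fderiv ℝ w x (b 0))]
  have hpos : 0 < ‖fderiv ℝ U x‖ := norm_pos_iff.2 hne
  set X := fderiv ℝ U x (b 0) * fderiv ℝ w x (b 0) + fderiv ℝ U x (b 1) * fderiv ℝ w x (b 1)
  have h1 : 2 * f (U x) * X ≤ (N * ‖fderiv ℝ U x‖) * (‖fderiv ℝ U x‖ * ‖fderiv ℝ w x‖) := by
    calc 2 * f (U x) * X ≤ |2 * f (U x) * X| := le_abs_self _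
      _ = (2 * |f (U x)|) * |X| := by rw [abs_mul, abs_mul, abs_two]
      _ ≤ _ := by gcongr; exact (by positivity : 0 ≤ 2 * |f (U x)|).trans hN
  have h2 : ‖fderiv ℝ U x‖ ^ 2 * (-N * ‖fderiv ℝ w x‖) ≤
      ‖fderiv ℝ U x‖ ^ 2 * Laplacian.laplacian w x := by
    rw [h]; nlinarith [sq_nonneg ‖fderiv ℝ w x‖]
  exact le_of_mul_le_mul_left h2 (by positivity)

end Identity

/-! ### Orthonormal frames and the boundary as a local graph. -/

section Frame

variable (b : OrthonormalBasis (Fin 2) ℝ Plane) (p : Plane)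

theorem frame_expansion (z : Plane) : z = p + ⟪b 0, z - p⟫ • b 0 + ⟪b 1, z - p⟫ • b 1 := by
  have h := b.sum_repr' (z - p)
  rw [Fin.sum_univ_two] at h
  rw [add_assoc, h]; abel

theorem inner_frame_zero_zero : ⟪b 0, b 0⟫ = (1 : ℝ) := by
  simp

theorem inner_frame_one_one : ⟪b 1, b 1⟫ = (1 : ℝ) := by
  simp

theorem inner_frame_zero_one : ⟪b 0, b 1⟫ = (0 : ℝ) := b.orthonormal.2 (by decide)

theorem inner_frame_one_zero : ⟪b 1, b 0⟫ = (0 : ℝ) := b.orthonormal.2 (by decide)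

theorem frame_coord_zero (x y : ℝ) : ⟪b 0, p + x • b 0 + y • b 1 - p⟫ = x := by
  rw [show p + x • b 0 + y • b 1 - p = x • b 0 + y • b 1 by abel, inner_add_right,
    inner_smul_right, inner_smul_right, inner_frame_zero_zero, inner_frame_zero_one]
  simp

theorem frame_coord_one (x y : ℝ) : ⟪b 1, p + x • b 0 + y • b 1 - p⟫ = y := by
  rw [show p + x • b 0 + y • b 1 - p = x • b 0 + y • b 1 by abel, inner_add_right,
    inner_smul_right, inner_smul_right, inner_frame_one_zero, inner_frame_one_one]
  simp

theorem tendsto_frame_coord (i : Fin 2) :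
    Filter.Tendsto (fun z : Plane => ⟪b i, z - p⟫) (𝓝 p) (𝓝 (0 : ℝ)) := by
  have : Continuous (fun z : Plane => ⟪b i, z - p⟫) := by fun_prop
  simpa using this.tendsto p

theorem exists_frame {ν : Plane} (hν : ‖ν‖ = 1) :
    ∃ b : OrthonormalBasis (Fin 2) ℝ Plane, b 1 = ν := by
  obtain ⟨b, hb⟩ := Orthonormal.exists_orthonormalBasis_extension_of_card_eq (𝕜 := ℝ)
    (E := Plane) (ι := Fin 2) (by simp) (v := fun _ => ν) (s := {1}) (by
      refine ⟨fun _ => hν, fun i j hij => ?_⟩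
      exact absurd (Subsingleton.elim i j) hij)
  exact ⟨b, hb 1 rfl⟩

end Frame

/-- Near `p`, in the frame `b`, the set `D` is the region strictly below the graph of the `C^n`
function `g`, whose graph is tangent to `b 0` at `p`. -/
structure IsSubgraphNear (n : WithTop ℕ∞) (D : Set Plane) (p : Plane)
    (b : OrthonormalBasis (Fin 2) ℝ Plane) (g : ℝ → ℝ) : Prop where
  contDiffAt : ContDiffAt ℝ n g 0
  apply_zero : g 0 = 0
  deriv_zero : deriv g 0 = 0
  mem_iff : ∀ᶠ z in 𝓝 p, (z ∈ D ↔ ⟪b 1, z - p⟫ < g ⟪b 0, z - p⟫)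

theorem IsOutwardUnitNormal.norm_eq_one {D : Set Plane} {p ν : Plane}
    (h : IsOutwardUnitNormal D p ν) : ‖ν‖ = 1 := by
  obtain ⟨φ, -, -, hne, -, rfl⟩ := h
  rw [norm_smul, norm_inv, norm_norm, inv_mul_cancel₀ (norm_ne_zero_iff.2 hne)]

/-- The implicit function theorem in a frame whose second axis is the normal: `φ` has positive
derivative along it, so its zero set is a graph and `φ < 0` means lying below it. -/
theorem IsOutwardUnitNormal.exists_isSubgraphNear {D : Set Plane} {p ν : Plane}
    (h : IsOutwardUnitNormal D p ν) (b : OrthonormalBasis (Fin 2) ℝ Plane) (hb : b 1 = ν) :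
    ∃ g, IsSubgraphNear 1 D p b g := by
  obtain ⟨φ, hφ, hφ0, hne, hD, hν⟩ := h
  set c := ‖gradient φ p‖ with hc
  have hcpos : 0 < c := norm_pos_iff.2 hne
  have hgrad : gradient φ p = c • b 1 := by
    rw [hb, hν, smul_smul, mul_inv_cancel₀ hcpos.ne', one_smul]
  have hfd : ∀ v, fderiv ℝ φ p v = c * ⟪b 1, v⟫ := fun v => by
    rw [← inner_gradient_left, hgrad, real_inner_smul_left]
  set A : ℝ × ℝ → Plane := fun s => p + s.1 • b 0 + s.2 • b 1 with hA
  have hA0 : A (0, 0) = p := by simp [hA]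
  have hAd : ∀ s, HasFDerivAt A ((ContinuousLinearMap.fst ℝ ℝ ℝ).smulRight (b 0) +
      (ContinuousLinearMap.snd ℝ ℝ ℝ).smulRight (b 1)) s := fun s =>
    ((hasFDerivAt_fst.smul_const (b 0)).const_add p).add (hasFDerivAt_snd.smul_const (b 1))
  have hAC : ContDiff ℝ 1 A := by
    apply ContDiff.add (contDiff_const.add (contDiff_fst.smul contDiff_const))
      (contDiff_snd.smul contDiff_const)
  set ψ : ℝ × ℝ → ℝ := fun s => φ (A s) with hψ
  have hψC : ContDiffAt ℝ 1 ψ (0, 0) := by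
    refine ContDiffAt.comp _ ?_ hAC.contDiffAt
    rwa [hA0]
  have hψd : fderiv ℝ ψ (0, 0) = (fderiv ℝ φ p) ∘L ((ContinuousLinearMap.fst ℝ ℝ ℝ).smulRight (b 0)
      + (ContinuousLinearMap.snd ℝ ℝ ℝ).smulRight (b 1)) := by
    have h1 : HasFDerivAt φ (fderiv ℝ φ p) (A (0, 0)) := by
      rw [hA0]; exact (hφ.differentiableAt (by norm_num)).hasFDerivAt
    exact (h1.comp _ (hAd _)).fderiv
  have hinr : fderiv ℝ ψ (0, 0) ∘L .inr ℝ ℝ ℝ =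
      (ContinuousLinearEquiv.unitsEquivAut ℝ (Units.mk0 c hcpos.ne') : ℝ →L[ℝ] ℝ) := by
    ext
    rw [hψd]
    simp [hfd]
  have hinv : (fderiv ℝ ψ (0, 0) ∘L .inr ℝ ℝ ℝ).IsInvertible := ⟨_, hinr.symm⟩
  set g := hψC.implicitFunction one_ne_zero hinv with hg
  have hg0 : g 0 = 0 := hψC.implicitFunction_apply_self one_ne_zero hinv
  have hgC : ContDiffAt ℝ 1 g 0 := hψC.contDiffAt_implicitFunction one_ne_zero hinv
  have hψ0 : ψ (0, 0) = 0 := by simp only [hψ, hA0, hφ0]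
  refine ⟨g, hgC, hg0, ?_, ?_⟩
  · have h1 := (hψC.hasStrictFDerivAt_implicitFunction one_ne_zero hinv).hasFDerivAt.hasDerivAt
    have h2 := h1.deriv
    refine h2.trans ?_
    have h3 : (fderiv ℝ ψ (0, 0) ∘L .inl ℝ ℝ ℝ) 1 = 0 := by
      rw [hψd]
      simp [hfd]
    exact (congrArg (⇑(-(fderiv ℝ ψ (0, 0) ∘L .inr ℝ ℝ ℝ).inverse)) h3).trans (map_zero _)
  have hgev : ∀ᶠ x in 𝓝 (0 : ℝ), ψ (x, g x) = 0 := by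
    have := hψC.eventually_apply_implicitFunction one_ne_zero hinv
    rwa [hψ0] at this
  have hpos : ∀ᶠ s in 𝓝 ((0 : ℝ), (0 : ℝ)), DifferentiableAt ℝ ψ s ∧ 0 < fderiv ℝ ψ s (0, 1) := by
    have h1 : ContinuousAt (fun s => fderiv ℝ ψ s (0, 1)) ((0 : ℝ), (0 : ℝ)) :=
      (hψC.fderiv_right (m := 0) (by norm_num)).continuousAt.clm_apply continuousAt_const
    have h2 : 0 < fderiv ℝ ψ (0, 0) (0, 1) := by
      rw [hψd]; simpa [hfd, inner_frame_one_one] using hcpos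
    filter_upwards [h1.eventually (lt_mem_nhds h2), hψC.eventually (by simp)] with s h3 h4
      using ⟨h4.differentiableAt one_ne_zero, h3⟩
  obtain ⟨ρ, hρ, hball⟩ := Metric.eventually_nhds_iff.1 hpos
  have hbox : ∀ x y : ℝ, |x| < ρ → |y| < ρ → DifferentiableAt ℝ ψ (x, y) ∧
      0 < fderiv ℝ ψ (x, y) (0, 1) := fun x y hx hy =>
    hball (by rw [Prod.dist_eq, max_lt_iff]; simpa using ⟨hx, hy⟩)
  have hmono : ∀ x : ℝ, |x| < ρ → StrictMonoOn (fun y => ψ (x, y)) (Set.Ioo (-ρ) ρ) := by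
    intro x hx
    have hd : ∀ y ∈ Set.Ioo (-ρ) ρ, HasDerivAt (fun y => ψ (x, y)) (fderiv ℝ ψ (x, y) (0, 1)) y :=
      fun y hy => (hbox x y hx (abs_lt.2 hy)).1.hasFDerivAt.comp_hasDerivAt y
        ((hasDerivAt_const y x).prodMk (hasDerivAt_id y))
    refine strictMonoOn_of_deriv_pos (convex_Ioo _ _)
      (fun y hy => (hd y hy).continuousAt.continuousWithinAt) fun y hy => ?_
    rw [interior_Ioo] at hy
    rw [(hd y hy).deriv]
    exact (hbox x y hx (abs_lt.2 hy)).2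
  have hsmall : ∀ᶠ t in 𝓝 (0 : ℝ), |t| < ρ := by
    have : Filter.Tendsto (fun t : ℝ => |t|) (𝓝 0) (𝓝 0) := by
      simpa using (continuous_abs (G := ℝ)).tendsto 0
    exact this.eventually (gt_mem_nhds hρ)
  have hgsmall : ∀ᶠ x in 𝓝 (0 : ℝ), |g x| < ρ := by
    have : Filter.Tendsto g (𝓝 0) (𝓝 0) := by simpa [hg0] using hgC.continuousAt.tendsto
    exact this.eventually hsmall
  filter_upwards [hD, (tendsto_frame_coord b p 0).eventually hgev,
    (tendsto_frame_coord b p 0).eventually hsmall, (tendsto_frame_coord b p 0).eventually hgsmall,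
    (tendsto_frame_coord b p 1).eventually hsmall] with z h1 h2 h3 h4 h5
  -- Monotonicity in the normal variable turns `ψ(x, y) < 0 = ψ(x, g x)` into `y < g x`.
  have h6 := (hmono _ h3).lt_iff_lt (abs_lt.1 h5) (abs_lt.1 h4)
  rw [h1, ← h6]
  simp only [h2]
  simp only [hψ, hA, ← frame_expansion b p z]

section Subgraph

variable {n : WithTop ℕ∞} {D : Set Plane} {p : Plane} {b : OrthonormalBasis (Fin 2) ℝ Plane}
  {g : ℝ → ℝ}

/-- The parametrization of the boundary curve of a subgraph. -/
def graphCurve (p : Plane) (b : OrthonormalBasis (Fin 2) ℝ Plane) (g : ℝ → ℝ) (x : ℝ) : Plane :=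
  p + x • b 0 + g x • b 1

theorem hasDerivAt_graphCurve {x g' : ℝ} (hg : HasDerivAt g g' x) :
    HasDerivAt (graphCurve p b g) (b 0 + g' • b 1) x := by
  have h := (((hasDerivAt_id x).smul_const (b 0)).const_add p).add (hg.smul_const (b 1))
  rw [one_smul] at h
  exact h

theorem IsSubgraphNear.hasDerivAt_zero (h : IsSubgraphNear n D p b g) (hn : n ≠ 0) :
    HasDerivAt g 0 0 := by
  have := (h.contDiffAt.differentiableAt hn).hasDerivAt
  rwa [h.deriv_zero] at this

/-- An open triangle with vertex `p` inside the frame `b`, pointing in the direction `-b 1`. -/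
def frameTriangle (p : Plane) (b : OrthonormalBasis (Fin 2) ℝ Plane) (ε : ℝ) : Set Plane :=
  {z | ⟪b 0 + b 1, z⟫ < ⟪b 0 + b 1, p⟫} ∩ {z | ⟪b 1 - b 0, z⟫ < ⟪b 1 - b 0, p⟫} ∩
    {z | ⟪-b 1, z⟫ < ⟪-b 1, p⟫ + ε}

theorem mem_frameTriangle {ε : ℝ} {z : Plane} : z ∈ frameTriangle p b ε ↔
    |⟪b 0, z - p⟫| < -⟪b 1, z - p⟫ ∧ -⟪b 1, z - p⟫ < ε := by
  simp only [frameTriangle, Set.mem_inter_iff, Set.mem_ofPred_eq, inner_add_left, inner_sub_left,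
    inner_neg_left, inner_sub_right, abs_lt]
  constructor
  · rintro ⟨⟨h1, h2⟩, h3⟩; refine ⟨⟨?_, ?_⟩, ?_⟩ <;> linarith
  · rintro ⟨⟨h1, h2⟩, h3⟩; refine ⟨⟨?_, ?_⟩, ?_⟩ <;> linarith

theorem convex_frameTriangle (ε : ℝ) : Convex ℝ (frameTriangle p b ε) := by
  have key : ∀ (v : Plane) (r : ℝ), Convex ℝ {z : Plane | ⟪v, z⟫ < r} := fun v r =>
    convex_halfSpace_lt (innerSL ℝ v).toLinearMap.isLinear r
  exact ((key _ _).inter (key _ _)).inter (key _ _)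

theorem isOpen_frameTriangle (ε : ℝ) : IsOpen (frameTriangle p b ε) := by
  refine (IsOpen.inter ?_ ?_).inter ?_ <;>
  exact isOpen_lt (by fun_prop) continuous_const

theorem below_mem_frameTriangle {ε t : ℝ} (ht : 0 < t) (htε : t < ε) :
    p - t • b 1 ∈ frameTriangle p b ε := by
  have h0 := frame_coord_zero b p 0 (-t)
  have h1 := frame_coord_one b p 0 (-t)
  have : p - t • b 1 = p + (0 : ℝ) • b 0 + (-t) • b 1 := by simp [sub_eq_add_neg]
  rw [mem_frameTriangle, this, h0, h1]
  simp [ht, htε]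

theorem mem_closure_frameTriangle {ε : ℝ} (hε : 0 < ε) : p ∈ closure (frameTriangle p b ε) := by
  have h1 : Filter.Tendsto (fun t : ℝ => p - t • b 1) (𝓝[>] 0) (𝓝 p) := by
    have : Continuous (fun t : ℝ => p - t • b 1) := by fun_prop
    simpa using (this.tendsto 0).mono_left nhdsWithin_le_nhds
  refine mem_closure_of_tendsto h1 ?_
  filter_upwards [Ioo_mem_nhdsGT hε] with t ht using below_mem_frameTriangle ht.1 ht.2

/-- Since `g(0) = g'(0) = 0`, the graph stays inside the cone `|y| ≤ |x|` near `p`. A triangle,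
unlike an interior disk, needs only `C¹` regularity. -/
theorem IsSubgraphNear.exists_frameTriangle_subset (h : IsSubgraphNear n D p b g) (hn : n ≠ 0) :
    ∃ ε > 0, frameTriangle p b ε ⊆ D := by
  have hlin : ∀ᶠ x in 𝓝 (0 : ℝ), |g x| ≤ |x| := by
    have h1 := (h.hasDerivAt_zero hn).isLittleO.bound (c := 1) one_pos
    filter_upwards [h1] with x hx
    simpa [h.apply_zero] using hx
  obtain ⟨δ, hδ, hball⟩ := Metric.eventually_nhds_iff.1
    (h.mem_iff.and ((tendsto_frame_coord b p 0).eventually hlin))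
  refine ⟨δ / 2, by positivity, fun z hz => ?_⟩
  rw [mem_frameTriangle] at hz
  obtain ⟨h1, h2⟩ := hz
  have hdist : dist z p < δ := by
    rw [dist_eq_norm]
    have h3 := b.sum_sq_norm_inner_right (z - p)
    rw [Fin.sum_univ_two] at h3
    simp only [Real.norm_eq_abs] at h3
    have h4 : |⟪b 1, z - p⟫| < δ / 2 := by
      rw [abs_of_neg]
      · exact h2
      · linarith [abs_nonneg ⟪b 0, z - p⟫]
    have h5 : |⟪b 0, z - p⟫| < δ / 2 := h1.trans h2
    have h6 := abs_nonneg ⟪b 0, z - p⟫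
    have h7 := abs_nonneg ⟪b 1, z - p⟫
    refine lt_of_pow_lt_pow_left₀ 2 hδ.le ?_
    nlinarith
  obtain ⟨h3, h4⟩ := hball hdist
  rw [h3]
  have := neg_le_of_abs_le h4
  linarith [neg_abs_le (g ⟪b 0, z - p⟫)]

/-- Makes derivatives relative to the closure well defined at boundary points. -/
theorem IsSubgraphNear.uniqueDiffWithinAt (h : IsSubgraphNear n D p b g) (hn : n ≠ 0) :
    UniqueDiffWithinAt ℝ D p := by
  obtain ⟨ε, hε, hsub⟩ := h.exists_frameTriangle_subset hn
  refine (uniqueDiffWithinAt_convex (convex_frameTriangle ε) ?_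
    (mem_closure_frameTriangle hε)).mono hsub
  rw [(isOpen_frameTriangle ε).interior_eq]
  exact ⟨_, below_mem_frameTriangle (half_pos hε) (half_lt_self hε)⟩

theorem tendsto_graphCurve (hg : ContinuousAt g 0) (h0 : g 0 = 0) :
    Filter.Tendsto (graphCurve p b g) (𝓝 0) (𝓝 p) := by
  have h1 : ContinuousAt (graphCurve p b g) 0 :=
    (continuousAt_const.add (continuousAt_id.smul continuousAt_const)).add
      (hg.smul continuousAt_const)
  have h2 : graphCurve p b g 0 = p := by simp [graphCurve, h0]
  simpa only [ContinuousAt, h2] using h1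

theorem IsSubgraphNear.eventually_mem_frontier (h : IsSubgraphNear n D p b g) (hD : IsOpen D) :
    ∀ᶠ x in 𝓝 (0 : ℝ), graphCurve p b g x ∈ frontier D := by
  have h1 := (tendsto_graphCurve (p := p) (b := b) h.contDiffAt.continuousAt
    h.apply_zero).eventually (eventually_eventually_nhds.2 h.mem_iff)
  filter_upwards [h1] with x hx
  rw [hD.frontier_eq]
  constructor
  · have h2 : Filter.Tendsto (fun t : ℝ => graphCurve p b g x - t • b 1) (𝓝[>] 0)
        (𝓝 (graphCurve p b g x)) := by
      have : Continuous (fun t : ℝ => graphCurve p b g x - t • b 1) := by fun_prop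
      simpa using (this.tendsto 0).mono_left nhdsWithin_le_nhds
    refine mem_closure_of_tendsto h2 ?_
    filter_upwards [h2.eventually hx, self_mem_nhdsWithin] with t ht ht0
    have h3 : graphCurve p b g x - t • b 1 = p + x • b 0 + (g x - t) • b 1 := by
      rw [graphCurve]; module
    rw [ht, h3, frame_coord_zero, frame_coord_one]
    have : (0 : ℝ) < t := ht0
    linarith
  · rw [hx.self_of_nhds, graphCurve, frame_coord_zero, frame_coord_one]
    exact lt_irrefl _

end Subgraph

theorem HasDerivWithinAt.le_of_forall_le {h : ℝ → ℝ} {h' m δ : ℝ} (hδ : 0 < δ)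
    (hd : HasDerivWithinAt h h' (Set.Ici 0) 0)
    (hle : ∀ t ∈ Set.Icc (0 : ℝ) δ, h t ≤ h 0 - m * t) : h' ≤ -m := by
  rw [hasDerivWithinAt_iff_tendsto_slope, Set.Ici_sdiff_left] at hd
  refine le_of_tendsto hd ?_
  filter_upwards [Ioo_mem_nhdsGT hδ] with t ht
  rw [slope_def_field, sub_zero, div_le_iff₀ ht.1]
  have := hle t ⟨ht.1.le, ht.2.le⟩
  linarith

/-- A solution `U` in an open set `D` of the plane of the overdetermined problem
`Δ U + f(U) = 0`, `U > 0` in `D`, `U = 0` and `∂U/∂ν = α` on the `C¹` boundary of `D`, together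
with a primitive `F` of `f`. -/
structure IsPlaneSolution (D : Set Plane) (f F : ℝ → ℝ) (α : ℝ) (U : Plane → ℝ) : Prop where
  isOpen : IsOpen D
  hasC1Boundary : HasC1Boundary D
  contDiffOn_closure : ContDiffOn ℝ 2 U (closure D)
  contDiffOn : ContDiffOn ℝ 3 U D
  continuous_f : Continuous f
  contDiffAt_f : ∀ x ∈ D, ContDiffAt ℝ 1 f (U x)
  hasDerivAt_F : ∀ s, HasDerivAt F (f s) s
  F_zero : F 0 = 0
  equation : ∀ x ∈ D, Laplacian.laplacian U x + f (U x) = 0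
  pos : ∀ x ∈ D, 0 < U x
  dirichlet : ∀ x ∈ frontier D, U x = 0
  neumann : ∀ x ∈ frontier D, ∀ ν, IsOutwardUnitNormal D x ν →
    fderivWithin ℝ U (closure D) x ν = α

/-! ### Solutions on plane domains: regularity up to the boundary and the maximum principle. -/

namespace IsPlaneSolution

variable {D : Set Plane} {f F : ℝ → ℝ} {α : ℝ} {U : Plane → ℝ}

theorem uniqueDiffOn (h : IsPlaneSolution D f F α U) : UniqueDiffOn ℝ (closure D) := by
  intro x hx
  rw [closure_eq_self_union_frontier] at hx
  rcases hx with hx | hx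
  · exact (h.isOpen.uniqueDiffWithinAt hx).mono subset_closure
  · obtain ⟨ν, hν⟩ := h.hasC1Boundary x hx
    obtain ⟨b, hb⟩ := exists_frame hν.norm_eq_one
    obtain ⟨g, hg⟩ := hν.exists_isSubgraphNear b hb
    exact (hg.uniqueDiffWithinAt one_ne_zero).mono subset_closure

theorem contDiffOn_fderivWithin (h : IsPlaneSolution D f F α U) :
    ContDiffOn ℝ 1 (fderivWithin ℝ U (closure D)) (closure D) :=
  h.contDiffOn_closure.fderivWithin h.uniqueDiffOn (by norm_num)

theorem hasFDerivWithinAt (h : IsPlaneSolution D f F α U) {x : Plane} (hx : x ∈ closure D) :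
    HasFDerivWithinAt U (fderivWithin ℝ U (closure D) x) (closure D) x :=
  (h.contDiffOn_closure.differentiableOn (by norm_num) x hx).hasFDerivWithinAt

theorem hasFDerivWithinAt_fderivWithin (h : IsPlaneSolution D f F α U) {x : Plane}
    (hx : x ∈ closure D) :
    HasFDerivWithinAt (fderivWithin ℝ U (closure D))
      (fderivWithin ℝ (fderivWithin ℝ U (closure D)) (closure D) x) (closure D) x :=
  (h.contDiffOn_fderivWithin.differentiableOn (by norm_num) x hx).hasFDerivWithinAt

theorem fderivWithin_eventuallyEq (h : IsPlaneSolution D f F α U) {x : Plane} (hx : x ∈ D) :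
    fderivWithin ℝ U (closure D) =ᶠ[𝓝 x] fderiv ℝ U := by
  filter_upwards [h.isOpen.mem_nhds hx] with y hy
  exact fderivWithin_of_mem_nhds (Filter.mem_of_superset (h.isOpen.mem_nhds hy) subset_closure)

theorem pFunction_eventuallyEq (h : IsPlaneSolution D f F α U) {x : Plane} (hx : x ∈ D) :
    pFunction F U (fderivWithin ℝ U (closure D)) =ᶠ[𝓝 x] pFunction F U (fderiv ℝ U) := by
  filter_upwards [h.fderivWithin_eventuallyEq hx] with y hy
  simp only [pFunction, hy]

/-- Both sides are continuous on the closure because `U` is `C²` up to the boundary, so the equation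
passes to the limit. -/
theorem equation_closure (h : IsPlaneSolution D f F α U) (b : OrthonormalBasis (Fin 2) ℝ Plane)
    {x : Plane} (hx : x ∈ closure D) :
    fderivWithin ℝ (fderivWithin ℝ U (closure D)) (closure D) x (b 0) (b 0) +
      fderivWithin ℝ (fderivWithin ℝ U (closure D)) (closure D) x (b 1) (b 1) + f (U x) = 0 := by
  have hH : ContinuousOn (fderivWithin ℝ (fderivWithin ℝ U (closure D)) (closure D)) (closure D) :=
    h.contDiffOn_fderivWithin.continuousOn_fderivWithin h.uniqueDiffOn (by norm_num)
  have hc : ∀ i, ContinuousOn (fun x =>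
      fderivWithin ℝ (fderivWithin ℝ U (closure D)) (closure D) x (b i) (b i)) (closure D) :=
    fun i => (hH.clm_apply continuousOn_const).clm_apply continuousOn_const
  have hEq : Set.EqOn (fun x =>
      fderivWithin ℝ (fderivWithin ℝ U (closure D)) (closure D) x (b 0) (b 0) +
      fderivWithin ℝ (fderivWithin ℝ U (closure D)) (closure D) x (b 1) (b 1) + f (U x))
      (fun _ => 0) D := by
    intro y hy
    have h1 := h.equation y hy
    rw [laplacian_eq_sum_orthonormalBasis b] at h1
    have h2 : fderivWithin ℝ (fderivWithin ℝ U (closure D)) (closure D) y =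
        fderiv ℝ (fderiv ℝ U) y := by
      rw [fderivWithin_of_mem_nhds
        (Filter.mem_of_superset (h.isOpen.mem_nhds hy) subset_closure),
        (h.fderivWithin_eventuallyEq hy).fderiv_eq]
    simp only [h2]
    exact h1
  exact hEq.of_subset_closure (((hc 0).add (hc 1)).add
    (h.continuous_f.comp_continuousOn h.contDiffOn_closure.continuousOn)) continuousOn_const
    subset_closure subset_rfl hx

theorem continuousOn_pFunction (h : IsPlaneSolution D f F α U) :
    ContinuousOn (pFunction F U (fderivWithin ℝ U (closure D))) (closure D) := by
  have hF : Continuous F := continuous_iff_continuousAt.2 fun s => (h.hasDerivAt_F s).continuousAt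
  exact (h.contDiffOn_fderivWithin.continuousOn.norm.pow 2).add
    (continuousOn_const.mul (hF.comp_continuousOn h.contDiffOn_closure.continuousOn))

theorem contDiffAt_pFunction (h : IsPlaneSolution D f F α U) {x : Plane} (hx : x ∈ D) :
    ContDiffAt ℝ 2 (pFunction F U (fderivWithin ℝ U (closure D))) x :=
  (_root_.contDiffAt_pFunction (h.contDiffOn.contDiffAt (h.isOpen.mem_nhds hx))
    (h.contDiffAt_f x hx) h.hasDerivAt_F).congr_of_eventuallyEq (h.pFunction_eventuallyEq hx)

/-- The factor `2|f(U)| / |∇U|` is bounded near `x₀` by continuity up to the boundary. Boundary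
points are allowed because Hopf's lemma is applied there. -/
theorem exists_laplacian_pFunction_ge (h : IsPlaneSolution D f F α U) {x₀ : Plane}
    (hx₀ : x₀ ∈ closure D) (hne : fderivWithin ℝ U (closure D) x₀ ≠ 0) :
    ∃ N : ℝ, ∀ᶠ x in 𝓝 x₀, x ∈ D →
      -N * ‖fderiv ℝ (pFunction F U (fderivWithin ℝ U (closure D))) x‖ ≤
        Laplacian.laplacian (pFunction F U (fderivWithin ℝ U (closure D))) x := by
  set G := fderivWithin ℝ U (closure D) with hG
  set c := ‖G x₀‖ / 2 with hc
  have hcpos : 0 < c := half_pos (norm_pos_iff.2 hne)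
  have h1 : ∀ᶠ x in 𝓝[closure D] x₀, c < ‖G x‖ :=
    (h.contDiffOn_fderivWithin.continuousOn x₀ hx₀).norm.eventually
      (lt_mem_nhds (half_lt_self (norm_pos_iff.2 hne)))
  have h2 : ∀ᶠ x in 𝓝[closure D] x₀, |f (U x)| < |f (U x₀)| + 1 :=
    (h.continuous_f.comp_continuousOn h.contDiffOn_closure.continuousOn x₀ hx₀).abs.eventually
      (gt_mem_nhds (lt_add_one _))
  refine ⟨2 * (|f (U x₀)| + 1) / c, ?_⟩
  filter_upwards [eventually_nhdsWithin_iff.1 h1, eventually_nhdsWithin_iff.1 h2] with x h3 h4 hx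
  have h3 := h3 (subset_closure hx)
  have h4 := h4 (subset_closure hx)
  have hGx : G x = fderiv ℝ U x := (h.fderivWithin_eventuallyEq hx).self_of_nhds
  rw [hGx] at h3
  have heq := h.pFunction_eventuallyEq hx
  rw [heq.fderiv_eq, (InnerProductSpace.laplacian_congr_nhds heq).self_of_nhds]
  refine laplacian_pFunction_ge (h.contDiffOn.contDiffAt (h.isOpen.mem_nhds hx))
    (h.contDiffAt_f x hx) h.hasDerivAt_F ?_ (norm_pos_iff.1 (hcpos.trans h3)) ?_
  · filter_upwards [h.isOpen.mem_nhds hx] with y hy using h.equation y hy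
  · have h5 : 2 * |f (U x)| ≤ 2 * (|f (U x₀)| + 1) := by linarith
    refine h5.trans ?_
    rw [div_mul_eq_mul_div, le_div_iff₀ hcpos]
    gcongr

/-- Strong maximum principle for the `P`-function, local form. -/
theorem eventually_pFunction_eq (h : IsPlaneSolution D f F α U) {M : ℝ} {x₀ : Plane}
    (hM : ∀ x ∈ D, pFunction F U (fderivWithin ℝ U (closure D)) x ≤ M) (hx₀ : x₀ ∈ D)
    (hx₀M : pFunction F U (fderivWithin ℝ U (closure D)) x₀ = M)
    (hne : fderivWithin ℝ U (closure D) x₀ ≠ 0) :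
    ∀ᶠ x in 𝓝 x₀, pFunction F U (fderivWithin ℝ U (closure D)) x = M := by
  set P := pFunction F U (fderivWithin ℝ U (closure D)) with hP
  obtain ⟨N, hN⟩ := h.exists_laplacian_pFunction_ge (subset_closure hx₀) hne
  obtain ⟨ρ, hρ, hball⟩ := Metric.eventually_nhds_iff.1 (hN.and (h.isOpen.mem_nhds hx₀))
  filter_upwards [Metric.ball_mem_nhds x₀ (by positivity : 0 < ρ / 3)] with y hy
  by_contra hyM
  rw [Metric.mem_ball] at hy
  -- Let `z` be the point of the contact set nearest to `y`. In the open disk about `y` through `z`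
  -- one has `P < M`, so Hopf's lemma at `z` contradicts `∇P(z) = 0`. The radii keep this disk
  -- within `2ρ/3` of `x₀`.
  set E := Metric.closedBall x₀ (2 * ρ / 3) ∩ {x | P x = M} with hE
  have hsubD : ∀ x ∈ Metric.closedBall x₀ (2 * ρ / 3), x ∈ D := fun x hx =>
    (hball (by rw [Metric.mem_closedBall] at hx; linarith)).2
  have hPc : ContinuousOn P (Metric.closedBall x₀ (2 * ρ / 3)) :=
    h.continuousOn_pFunction.mono fun x hx => subset_closure (hsubD x hx)
  have hEc : IsCompact E := by
    have : IsClosed E := hPc.preimage_isClosed_of_isClosed Metric.isClosed_closedBall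
      (isClosed_singleton (x := M))
    exact (isCompact_closedBall x₀ _).of_isClosed_subset this Set.inter_subset_left
  have hx₀E : x₀ ∈ E := ⟨Metric.mem_closedBall_self (by positivity), hx₀M⟩
  obtain ⟨z, hzE, hzmin⟩ := hEc.exists_isMinOn ⟨x₀, hx₀E⟩
    (f := fun z => dist z y) (by fun_prop)
  have hzx₀ : dist z y ≤ dist x₀ y := hzmin hx₀E
  have hzM : P z = M := hzE.2
  rw [dist_comm x₀ y] at hzx₀
  have hzy : z ≠ y := fun he => hyM (he ▸ hzM)
  have hcl : ∀ x ∈ Metric.closedBall y (dist z y), dist x x₀ < 2 * ρ / 3 := fun x hx => by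
    rw [Metric.mem_closedBall] at hx
    linarith [dist_triangle x y x₀]
  have hzD : z ∈ D := hsubD z hzE.1
  have hlt : ∀ x ∈ Metric.ball y (dist z y), P x < P z := fun x hx => by
    have hxc := hcl x (Metric.ball_subset_closedBall hx)
    rw [hzM]
    refine lt_of_le_of_ne (hM x (hsubD x hxc.le)) fun hxM => ?_
    have : dist z y ≤ dist x y := hzmin ⟨hxc.le, hxM⟩
    rw [Metric.mem_ball] at hx
    linarith
  obtain ⟨m, hm, hmle⟩ := hopf_boundary_point_lemma hzy
    (hPc.mono fun x hx => (hcl x hx).le)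
    (fun x hx => h.contDiffAt_pFunction
      (hsubD x (hcl x (Metric.ball_subset_closedBall hx)).le))
    (fun x hx => by
      have hxc := hcl x (Metric.ball_subset_closedBall hx)
      exact (hball (show dist x x₀ < ρ by linarith)).1 (hsubD x hxc.le)) hlt
  have hloc : IsLocalMax P z := by
    filter_upwards [h.isOpen.mem_nhds hzD] with x hx
    rw [hzM]; exact hM x hx
  have hd0 : HasFDerivAt P (0 : Plane →L[ℝ] ℝ) z := by
    rw [← hloc.fderiv_eq_zero]
    exact ((h.contDiffAt_pFunction hzD).differentiableAt (by norm_num)).hasFDerivAt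
  have hline : HasDerivAt (fun t : ℝ => P (z + t • (y - z))) 0 0 := by
    have h1 := hasDerivAt_comp_line (w := P) (x := z) (e := y - z) (t := 0)
      (by simpa using hd0.differentiableAt)
    simpa [hd0.fderiv] using h1
  have := hline.hasDerivWithinAt.le_of_forall_le (m := m) (δ := 1 / 2) (by norm_num)
    (by simpa using hmle)
  linarith

/-- The boundary is of class `C²`; its curvature is read off from the second derivatives of `U`. -/
theorem exists_isSubgraphNear_two (h : IsPlaneSolution D f F α U) (hα : α ≠ 0) {p : Plane}
    (hp : p ∈ frontier D) :
    ∃ b g, IsSubgraphNear 2 D p b g ∧ fderivWithin ℝ U (closure D) p (b 0) = 0 ∧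
      fderivWithin ℝ U (closure D) p (b 1) = α ∧
      fderivWithin ℝ (fderivWithin ℝ U (closure D)) (closure D) p (b 0) (b 0) =
        -(α * deriv (deriv g) 0) := by
  obtain ⟨ν, hν⟩ := h.hasC1Boundary p hp
  obtain ⟨b, hb⟩ := exists_frame hν.norm_eq_one
  obtain ⟨g, hg⟩ := hν.exists_isSubgraphNear b hb
  set G := fderivWithin ℝ U (closure D) with hG
  set γ := graphCurve p b g with hγ
  have hγ0 : γ 0 = p := by simp [hγ, graphCurve, hg.apply_zero]
  have hfr := hg.eventually_mem_frontier h.isOpen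
  have hgd : ∀ᶠ x in 𝓝 (0 : ℝ), HasDerivAt g (deriv g x) x := by
    filter_upwards [hg.contDiffAt.eventually (by simp)] with x hx
    exact (hx.differentiableAt one_ne_zero).hasDerivAt
  have hGν : G p (b 1) = α := by rw [hb]; exact h.neumann p hp ν hν
  -- Derivative of the identity `U = 0` along the boundary curve.
  have htan : ∀ᶠ x in 𝓝 (0 : ℝ), G (γ x) (b 0) + deriv g x * G (γ x) (b 1) = 0 := by
    filter_upwards [hgd, eventually_eventually_nhds.2 hfr] with x hx hxf
    have h1 : HasDerivWithinAt (U ∘ γ) (G (γ x) (b 0 + deriv g x • b 1))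
        (γ ⁻¹' closure D) x :=
      (h.hasFDerivWithinAt (frontier_subset_closure hxf.self_of_nhds)).comp_hasDerivWithinAt x
        (hasDerivAt_graphCurve hx).hasDerivWithinAt (Set.mapsTo_preimage _ _)
    have h2 : γ ⁻¹' closure D ∈ 𝓝 x := by
      filter_upwards [hxf] with y hy using frontier_subset_closure hy
    have h3 : U ∘ γ =ᶠ[𝓝 x] fun _ => 0 := by
      filter_upwards [hxf] with y hy using h.dirichlet _ hy
    have h4 := (h1.hasDerivAt h2).deriv
    rw [h3.deriv_eq, deriv_const] at h4
    rw [map_add, map_smul, smul_eq_mul] at h4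
    exact h4.symm
  have hGτ : G p (b 0) = 0 := by
    have := htan.self_of_nhds
    rwa [hγ0, hg.deriv_zero, zero_mul, add_zero] at this
  have hpre : γ ⁻¹' closure D ∈ 𝓝 (0 : ℝ) := by
    filter_upwards [hfr] with y hy using frontier_subset_closure hy
  have hpc : p ∈ closure D := frontier_subset_closure hp
  have hγC : ContDiffAt ℝ 1 γ 0 :=
    (contDiffAt_const.add (contDiffAt_id.smul contDiffAt_const)).add
      (hg.contDiffAt.smul contDiffAt_const)
  have hGγ : ContDiffAt ℝ 1 (G ∘ γ) 0 := by
    have h1 : ContDiffWithinAt ℝ 1 G (closure D) (γ 0) := by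
      rw [hγ0]; exact h.contDiffOn_fderivWithin p hpc
    exact (h1.comp 0 hγC.contDiffWithinAt (Set.mapsTo_preimage γ (closure D))).contDiffAt hpre
  have hγd : HasDerivAt γ (b 0) 0 := by
    simpa using hasDerivAt_graphCurve (p := p) (b := b) (hg.hasDerivAt_zero one_ne_zero)
  set H := fderivWithin ℝ G (closure D) p with hH
  have hGγd : HasDerivAt (G ∘ γ) (H (b 0)) 0 := by
    have h1 : HasFDerivWithinAt G H (closure D) (γ 0) := by
      rw [hγ0]; exact h.hasFDerivWithinAt_fderivWithin hpc
    exact (h1.comp_hasDerivWithinAt 0 hγd.hasDerivWithinAt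
      (Set.mapsTo_preimage γ (closure D))).hasDerivAt hpre
  have hne : ∀ᶠ x in 𝓝 (0 : ℝ), G (γ x) (b 1) ≠ 0 := by
    have h1 : ContinuousAt (fun x => (G ∘ γ) x (b 1)) 0 :=
      hGγ.continuousAt.clm_apply continuousAt_const
    refine h1.eventually_ne ?_
    simp only [Function.comp_apply, hγ0, hGν]
    exact hα
  -- The tangency relation solved for `g'`. Its right-hand side is `C¹`, so `g` is in fact `C²`, and
  -- differentiating at `0` gives `g''(0) = -U_ττ / α`.
  set k : ℝ → ℝ := fun x => -(G ∘ γ) x (b 0) / (G ∘ γ) x (b 1) with hk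
  have hgk : deriv g =ᶠ[𝓝 0] k := by
    filter_upwards [htan, hne] with x h1 h2
    rw [hk]
    simp only [Function.comp_apply]
    rw [eq_div_iff h2]
    linarith
  have hkC : ContDiffAt ℝ 1 k 0 := by
    refine (hGγ.clm_apply contDiffAt_const).neg.div (hGγ.clm_apply contDiffAt_const) ?_
    exact hne.self_of_nhds
  have hg2 : ContDiffAt ℝ 2 g 0 := by
    refine contDiffAt_of_hasDerivAt hkC ?_
    filter_upwards [hgd, hgk] with x h1 h2
    rwa [← h2]
  have hk' : HasDerivAt k (-(H (b 0) (b 0)) / α) 0 := by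
    have h1 : HasDerivAt (fun x => (G ∘ γ) x (b 0)) (H (b 0) (b 0)) 0 := by
      simpa using hGγd.clm_apply (hasDerivAt_const (0 : ℝ) (b 0))
    have h2 : HasDerivAt (fun x => (G ∘ γ) x (b 1)) (H (b 0) (b 1)) 0 := by
      simpa using hGγd.clm_apply (hasDerivAt_const (0 : ℝ) (b 1))
    have h3 := h1.fun_neg.fun_div h2 hne.self_of_nhds
    simp only [Function.comp_apply, hγ0, hGτ, hGν] at h3
    exact h3.congr_deriv (by field_simp; ring)
  refine ⟨b, g, ⟨hg2, hg.apply_zero, hg.deriv_zero, hg.mem_iff⟩, hGτ, hGν, ?_⟩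
  rw [hgk.deriv_eq, hk'.deriv]
  field_simp

theorem norm_fderivWithin_sq_eq (h : IsPlaneSolution D f F α U) (hα : α ≠ 0) {p : Plane}
    (hp : p ∈ frontier D) : ‖fderivWithin ℝ U (closure D) p‖ ^ 2 = α ^ 2 := by
  obtain ⟨b, g, -, h0, h1, -⟩ := h.exists_isSubgraphNear_two hα hp
  rw [norm_sq_eq_sum_apply_sq b, h0, h1]; ring

theorem pFunction_eq_of_mem_frontier (h : IsPlaneSolution D f F α U) (hα : α ≠ 0) {p : Plane}
    (hp : p ∈ frontier D) : pFunction F U (fderivWithin ℝ U (closure D)) p = α ^ 2 := by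
  rw [pFunction, h.norm_fderivWithin_sq_eq hα hp, h.dirichlet p hp, h.F_zero]; ring

end IsPlaneSolution

/-! ### Geometry of `C²` boundaries: interior disks, curvature, local convexity. -/

theorem ContDiffAt.contDiffAt_deriv {g : ℝ → ℝ} {x : ℝ} {m n : WithTop ℕ∞}
    (hg : ContDiffAt ℝ n g x) (hmn : m + 1 ≤ n) : ContDiffAt ℝ m (deriv g) x := by
  have : deriv g = fun y => fderiv ℝ g y 1 := by ext y; exact fderiv_apply_one_eq_deriv.symm
  rw [this]
  exact (hg.fderiv_right hmn).clm_apply contDiffAt_const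

theorem ContDiffAt.eventually_abs_le_mul_sq {g : ℝ → ℝ} (hg : ContDiffAt ℝ 2 g 0) (h0 : g 0 = 0)
    (h1 : deriv g 0 = 0) : ∃ K > 0, ∀ᶠ x in 𝓝 (0 : ℝ), |g x| ≤ K * x ^ 2 := by
  have hd : DifferentiableAt ℝ (deriv g) 0 :=
    (hg.contDiffAt_deriv (m := 1) (by norm_num)).differentiableAt one_ne_zero
  set d := deriv (deriv g) 0
  have hg1 : ∀ᶠ x in 𝓝 (0 : ℝ), DifferentiableAt ℝ g x := by
    filter_upwards [hg.eventually (by simp)] with x hx using hx.differentiableAt (by norm_num)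
  obtain ⟨ρ, hρ, hball⟩ := Metric.eventually_nhds_iff_ball.1
    (hg1.and (hd.hasDerivAt.isLittleO.bound (c := 1) one_pos))
  refine ⟨|d| + 1, by positivity, ?_⟩
  filter_upwards [Metric.ball_mem_nhds 0 hρ] with x hx
  have hsub : ∀ y ∈ Metric.closedBall (0 : ℝ) |x|, y ∈ Metric.ball (0 : ℝ) ρ := fun y hy => by
    rw [mem_closedBall_zero_iff] at hy
    rw [mem_ball_zero_iff] at hx ⊢
    exact hy.trans_lt hx
  have h2 := (convex_closedBall (0 : ℝ) |x|).norm_image_sub_le_of_norm_deriv_le (f := g)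
    (C := (|d| + 1) * |x|) (fun y hy => (hball y (hsub y hy)).1) (fun y hy => ?_)
    (Metric.mem_closedBall_self (abs_nonneg x)) (y := x) (by simp)
  · rw [h0, sub_zero, sub_zero, Real.norm_eq_abs, Real.norm_eq_abs, mul_assoc, ← sq, sq_abs] at h2
    exact h2
  · have h3 := (hball y (hsub y hy)).2
    rw [mem_closedBall_zero_iff, Real.norm_eq_abs] at hy
    simp only [h1, sub_zero, smul_eq_mul, Real.norm_eq_abs, one_mul] at h3
    have h4 : |deriv g y| ≤ |deriv g y - y * d| + |y * d| := by
      simpa using abs_add_le (deriv g y - y * d) (y * d)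
    rw [abs_mul] at h4
    rw [Real.norm_eq_abs]
    nlinarith [abs_nonneg d, abs_nonneg y]

section Subgraph

variable {D : Set Plane} {p : Plane} {b : OrthonormalBasis (Fin 2) ℝ Plane} {g : ℝ → ℝ}

/-- The interior disk condition needed by Hopf's lemma. In such a disk `y < -x²/(2R)`, which lies
below `-Kx² ≤ g(x)` once `2KR < 1`. -/
theorem IsSubgraphNear.eventually_ball_subset (h : IsSubgraphNear 2 D p b g) :
    ∃ R₀ > 0, ∀ R, 0 < R → R < R₀ → Metric.ball (p - R • b 1) R ⊆ D := by
  obtain ⟨K, hK, hgK⟩ := h.contDiffAt.eventually_abs_le_mul_sq h.apply_zero h.deriv_zero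
  obtain ⟨δ, hδ, hball⟩ := Metric.eventually_nhds_iff.1
    (h.mem_iff.and ((tendsto_frame_coord b p 0).eventually hgK))
  refine ⟨min (δ / 2) (1 / (2 * K)), by positivity, fun R hR hR₀ z hz => ?_⟩
  obtain ⟨hR1, hR2⟩ := lt_min_iff.1 hR₀
  rw [Metric.mem_ball, dist_eq_norm] at hz
  have hzp : dist z p < δ := by
    have h1 : z - p = (z - (p - R • b 1)) - R • b 1 := by abel
    have h2 : ‖R • b 1‖ = R := by rw [norm_smul, b.norm_eq_one, Real.norm_of_nonneg hR.le, mul_one]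
    rw [dist_eq_norm, h1]
    linarith [norm_sub_le (z - (p - R • b 1)) (R • b 1)]
  obtain ⟨h1, h2⟩ := hball hzp
  rw [h1]
  have h3 := b.sum_sq_norm_inner_right (z - (p - R • b 1))
  rw [Fin.sum_univ_two] at h3
  have h4 : z - (p - R • b 1) = (z - p) + R • b 1 := by abel
  have h5 : ⟪b 0, z - (p - R • b 1)⟫ = ⟪b 0, z - p⟫ := by
    rw [h4, inner_add_right, inner_smul_right, inner_frame_zero_one]; simp
  have h6 : ⟪b 1, z - (p - R • b 1)⟫ = ⟪b 1, z - p⟫ + R := by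
    rw [h4, inner_add_right, inner_smul_right, inner_frame_one_one]; simp
  simp only [h5, h6, Real.norm_eq_abs, sq_abs] at h3
  set x := ⟪b 0, z - p⟫
  set y := ⟪b 1, z - p⟫
  have h7 : x ^ 2 + (y + R) ^ 2 < R ^ 2 := by
    rw [h3]; exact pow_lt_pow_left₀ hz (norm_nonneg _) two_ne_zero
  have h8 := neg_le_of_abs_le h2
  have h9 : R * (2 * K) < 1 := (lt_div_iff₀ (by positivity)).1 hR2
  have h10 : 2 * R * y < -(x ^ 2) := by nlinarith [sq_nonneg y]
  have h11 : 2 * R * (K * x ^ 2) ≤ x ^ 2 := by nlinarith [sq_nonneg x]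
  have h12 : 2 * R * y < 2 * R * (-(K * x ^ 2)) := by linarith
  have := lt_of_mul_lt_mul_left h12 (by positivity)
  linarith

/-- The complement is locally the epigraph of `g`, with defining function `g(x) - y`, whose Hessian
at `p` is `g''(0) x²`. -/
theorem IsSubgraphNear.hasPositiveBoundaryCurvatureAt_compl (h : IsSubgraphNear 2 D p b g)
    (hg : 0 < deriv (deriv g) 0) : HasPositiveBoundaryCurvatureAt Dᶜ p := by
  set a : Plane → ℝ := fun z => ⟪b 0, z - p⟫ with ha
  set l : Plane → ℝ := fun z => -⟪b 1, z - p⟫ with hl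
  have ha0 : a p = 0 := by simp [ha]
  have had : ∀ z, HasFDerivAt a (innerSL ℝ (b 0)) z := fun z =>
    (innerSL ℝ (b 0)).hasFDerivAt.comp z ((hasFDerivAt_id z).sub_const p)
  have hld : ∀ z, HasFDerivAt l (-innerSL ℝ (b 1)) z := fun z =>
    ((innerSL ℝ (b 1)).hasFDerivAt.comp z ((hasFDerivAt_id z).sub_const p)).neg
  have haC : ContDiffAt ℝ 2 a p := by
    apply ContDiff.contDiffAt
    exact contDiff_const.inner ℝ (contDiff_id.sub contDiff_const)
  have hlC : ContDiffAt ℝ 2 l p := by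
    apply ContDiff.contDiffAt
    exact (contDiff_const.inner ℝ (contDiff_id.sub contDiff_const)).neg
  have hgC : ContDiffAt ℝ 2 g (a p) := by rw [ha0]; exact h.contDiffAt
  have hgaC : ContDiffAt ℝ 2 (fun z => g (a z)) p := hgC.comp p haC
  have hda : fderiv ℝ a = fun _ => innerSL ℝ (b 0) := by ext1 z; exact (had z).fderiv
  have hdl : fderiv ℝ l = fun _ => -innerSL ℝ (b 1) := by ext1 z; exact (hld z).fderiv
  have hgev : ∀ᶠ s in 𝓝 (a p), HasDerivAt g (deriv g s) s := by
    filter_upwards [hgC.eventually (by simp)] with s hs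
    exact (hs.differentiableAt (by norm_num)).hasDerivAt
  have hgd2 : HasDerivAt (deriv g) (deriv (deriv g) 0) (a p) := by
    rw [ha0]
    exact ((h.contDiffAt.contDiffAt_deriv (m := 1) (by norm_num)).differentiableAt
      one_ne_zero).hasDerivAt
  have hfd : ∀ v, fderiv ℝ ((fun z => g (a z)) + l) p v = -⟪b 1, v⟫ := fun v => by
    have h1 : HasFDerivAt ((fun z => g (a z)) + l) _ p :=
      (hgev.self_of_nhds.comp_hasFDerivAt p (had p)).add (hld p)
    rw [h1.fderiv]
    simp [ha0, h.deriv_zero]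
  have hdd : ∀ t, fderiv ℝ (fderiv ℝ ((fun z => g (a z)) + l)) p t t =
      deriv (deriv g) 0 * ⟪b 0, t⟫ ^ 2 := fun t => by
    rw [fderiv_fderiv_add hgaC hlC, add_apply, add_apply,
      fderiv_fderiv_comp_scalar haC hgev hgd2, hda, hdl]
    simp
  refine ⟨(fun z => g (a z)) + l, hgaC.add hlC, by simp [ha0, hl, h.apply_zero], ?_, ?_, ?_⟩
  · intro h0
    have h1 := hfd (b 1)
    rw [← inner_gradient_left, h0, inner_zero_left, inner_frame_one_one] at h1
    norm_num at h1
  · filter_upwards [h.mem_iff] with z hz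
    rw [Set.mem_compl_iff, hz]
    simp only [Pi.add_apply, hl, ha, not_lt]
    constructor <;> intro <;> linarith
  · intro t ht htan
    rw [inner_gradient_left, hfd, neg_eq_zero] at htan
    rw [iteratedFDeriv_two_apply]
    simp only [Matrix.cons_val_zero, Matrix.cons_val_one]
    rw [hdd]
    have h0 : ⟪b 0, t⟫ ≠ 0 := fun h0 => ht <| by
      have := b.sum_repr' t
      rw [Fin.sum_univ_two, h0, htan] at this
      simpa using this.symm
    positivity

/-- By continuity `g''` stays positive near `0`, and the epigraph of a convex function is convex. -/
theorem IsSubgraphNear.exists_convex_compl_inter_ball (h : IsSubgraphNear 2 D p b g)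
    (hg : 0 < deriv (deriv g) 0) : ∃ r > 0, Convex ℝ (Dᶜ ∩ Metric.ball p r) := by
  have hev : ∀ᶠ x in 𝓝 (0 : ℝ), DifferentiableAt ℝ g x ∧ DifferentiableAt ℝ (deriv g) x ∧
      0 < deriv (deriv g) x := by
    have h1 : ContDiffAt ℝ 1 (deriv g) 0 := h.contDiffAt.contDiffAt_deriv (by norm_num)
    have h2 : ContinuousAt (deriv (deriv g)) 0 :=
      (h1.contDiffAt_deriv (m := 0) (by norm_num)).continuousAt
    filter_upwards [h.contDiffAt.eventually (by simp), h1.eventually (by simp),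
      h2.eventually (lt_mem_nhds hg)] with x h3 h4 h5
    exact ⟨h3.differentiableAt (by norm_num), h4.differentiableAt one_ne_zero, h5⟩
  obtain ⟨ρ, hρ, hρball⟩ := Metric.eventually_nhds_iff.1 hev
  have hconv : ConvexOn ℝ (Metric.ball (0 : ℝ) ρ) g := by
    refine convexOn_of_deriv2_nonneg' (convex_ball _ _)
      (fun x hx => (hρball hx).1.differentiableWithinAt)
      (fun x hx => (hρball hx).2.1.differentiableWithinAt) fun x hx => (hρball hx).2.2.le
  obtain ⟨r, hr, hball⟩ := Metric.eventually_nhds_iff.1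
    (h.mem_iff.and ((tendsto_frame_coord b p 0).eventually (Metric.ball_mem_nhds 0 hρ)))
  refine ⟨r, hr, ?_⟩
  have hmem : ∀ z ∈ Metric.ball p r, (z ∈ Dᶜ ↔ g ⟪b 0, z - p⟫ ≤ ⟪b 1, z - p⟫) := fun z hz => by
    rw [Set.mem_compl_iff, (hball hz).1, not_lt]
  rintro z ⟨hz, hzb⟩ w ⟨hw, hwb⟩ s t hs ht hst
  have hb := (convex_ball p r) hzb hwb hs ht hst
  refine ⟨?_, hb⟩
  rw [hmem _ hb]
  rw [hmem _ hzb] at hz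
  rw [hmem _ hwb] at hw
  have hcomb : s • z + t • w - p = s • (z - p) + t • (w - p) := by
    have : p = (s + t) • p := by rw [hst, one_smul]
    nth_rewrite 1 [this]
    module
  rw [hcomb, inner_add_right, inner_add_right, inner_smul_right, inner_smul_right,
    inner_smul_right, inner_smul_right]
  have h1 := hconv.2 (hball hzb).2 (hball hwb).2 hs ht hst
  simp only [smul_eq_mul] at h1
  have h2 := mul_le_mul_of_nonneg_left hz hs
  have h3 := mul_le_mul_of_nonneg_left hw ht
  linarith

end Subgraph

/-! ### Hopf's lemma read as positivity of the boundary curvature. -/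

namespace IsPlaneSolution

variable {D : Set Plane} {f F : ℝ → ℝ} {α : ℝ} {U : Plane → ℝ}

/-- If the `P`-function is smaller than its boundary values, then the complement of the domain is
strictly convex near each boundary point. -/
theorem exists_isSubgraphNear_deriv_pos (h : IsPlaneSolution D f F α U) (hα : α ≠ 0)
    (hP : ∀ x ∈ D, pFunction F U (fderivWithin ℝ U (closure D)) x < α ^ 2)
    {p : Plane} (hp : p ∈ frontier D) :
    ∃ b g, IsSubgraphNear 2 D p b g ∧ 0 < deriv (deriv g) 0 := by
  obtain ⟨b, g, hg, h0, h1, hH⟩ := h.exists_isSubgraphNear_two hα hp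
  refine ⟨b, g, hg, ?_⟩
  have hpc : p ∈ closure D := frontier_subset_closure hp
  set G := fderivWithin ℝ U (closure D) with hG
  set P := pFunction F U G with hPdef
  set H := fderivWithin ℝ G (closure D) p with hHdef
  have hGne : G p ≠ 0 := fun h2 => hα (by rw [← h1, h2]; rfl)
  have hPp : P p = α ^ 2 := h.pFunction_eq_of_mem_frontier hα hp
  obtain ⟨N, hN⟩ := h.exists_laplacian_pFunction_ge hpc hGne
  obtain ⟨ρ, hρ, hNball⟩ := Metric.eventually_nhds_iff.1 hN
  obtain ⟨R₀, hR₀, hR₀ball⟩ := hg.eventually_ball_subset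
  -- The disk must lie in `D` and, having diameter `2R < ρ`, in the region where the differential
  -- inequality holds.
  obtain ⟨R, hR, hRlt⟩ := exists_between (lt_min (half_pos hρ) hR₀)
  obtain ⟨hRρ, hRR₀⟩ := lt_min_iff.1 hRlt
  have hsub := hR₀ball R hR hRR₀
  have hdist : dist p (p - R • b 1) = R := by
    rw [dist_eq_norm, sub_sub_cancel, norm_smul, b.norm_eq_one, Real.norm_of_nonneg hR.le, mul_one]
  have hclsub : Metric.closedBall (p - R • b 1) R ⊆ closure D := by
    rw [← closure_ball _ hR.ne']; exact closure_mono hsub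
  obtain ⟨m, hm, hmle⟩ := hopf_boundary_point_lemma (w := P) (c := p - R • b 1) (p := p) (N := N)
    (by rw [← dist_pos, hdist]; exact hR)
    (by rw [hdist]; exact h.continuousOn_pFunction.mono hclsub)
    (by rw [hdist]; exact fun x hx => h.contDiffAt_pFunction (hsub hx))
    (by
      rw [hdist]
      intro x hx
      refine hNball ?_ (hsub hx)
      rw [Metric.mem_ball] at hx
      linarith [dist_triangle x (p - R • b 1) p, dist_comm p (p - R • b 1)])
    (by rw [hdist, hPp]; exact fun x hx => hP x (hsub hx))
  set e : Plane := (p - R • b 1) - p with he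
  have he' : e = -(R • b 1) := by rw [he]; abel
  have hmaps : ∀ t ∈ Set.Icc (0 : ℝ) 1, p + t • e ∈ closure D := fun t ht => by
    apply hclsub
    rw [Metric.mem_closedBall, dist_eq_norm, he',
      show p + t • -(R • b 1) - (p - R • b 1) = ((1 - t) * R) • b 1 by module, norm_smul,
      b.norm_eq_one, mul_one, Real.norm_of_nonneg (mul_nonneg (by linarith [ht.2]) hR.le)]
    nlinarith [ht.1]
  have hline : HasDerivWithinAt (fun t : ℝ => p + t • e) e (Set.Icc 0 1) 0 := by
    have : HasDerivAt (fun t : ℝ => p + t • e) e 0 := by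
      simpa using ((hasDerivAt_id (0 : ℝ)).smul_const e).const_add p
    exact this.hasDerivWithinAt
  have hUt : HasDerivWithinAt (fun t : ℝ => U (p + t • e)) (G p e) (Set.Icc 0 1) 0 := by
    have h2 : HasFDerivWithinAt U (G p) (closure D) (p + (0 : ℝ) • e) := by
      simpa using h.hasFDerivWithinAt hpc
    exact h2.comp_hasDerivWithinAt 0 hline hmaps
  have hGt : HasDerivWithinAt (fun t : ℝ => G (p + t • e)) (H e) (Set.Icc 0 1) 0 := by
    have h2 : HasFDerivWithinAt G H (closure D) (p + (0 : ℝ) • e) := by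
      simpa using h.hasFDerivWithinAt_fderivWithin hpc
    exact h2.comp_hasDerivWithinAt 0 hline hmaps
  have hGi : ∀ i, HasDerivWithinAt (fun t : ℝ => G (p + t • e) (b i)) (H e (b i))
      (Set.Icc 0 1) 0 := fun i => by
    simpa using hGt.clm_apply (hasDerivWithinAt_const (0 : ℝ) _ (b i))
  -- Here `∇U = αν`, so `∂P/∂ν = 2α(U_νν + f)`. The equation up to the boundary turns this into `-2α
  -- U_ττ = 2α² g''(0)`; the sign flips because `e = -Rν`.
  have hPt : HasDerivWithinAt (fun t : ℝ => P (p + t • e)) (2 * α * R * (α * -deriv (deriv g) 0))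
      (Set.Icc 0 1) 0 := by
    have h2 : (fun t : ℝ => P (p + t • e)) = fun t =>
        (G (p + t • e) (b 0) ^ 2 + G (p + t • e) (b 1) ^ 2) + 2 * F (U (p + t • e)) := by
      ext t
      rw [hPdef, pFunction, norm_sq_eq_sum_apply_sq b]
    have h3 := (((hGi 0).fun_pow 2).fun_add ((hGi 1).fun_pow 2)).fun_add
      (((h.hasDerivAt_F _).comp_hasDerivWithinAt 0 hUt).const_mul 2)
    rw [h2]
    refine h3.congr_deriv ?_
    have h4 := h.equation_closure b hpc
    simp only [zero_smul, add_zero, h0, h1, he', map_neg, map_smul, neg_apply, smul_apply,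
      smul_eq_mul]
    rw [hH] at h4
    push_cast
    linear_combination (-2 * α * R) * h4
  have hle : 2 * α * R * (α * -deriv (deriv g) 0) ≤ -m := by
    refine HasDerivWithinAt.le_of_forall_le (δ := 1 / 2) (by norm_num)
      (h := fun t => P (p + t • e)) ?_ (by simpa using hmle)
    exact hPt.mono_of_mem_nhdsWithin (Icc_mem_nhdsGE one_pos)
  have : 0 < (2 * α ^ 2 * R) * deriv (deriv g) 0 := by nlinarith
  exact pos_of_mul_pos_right this (by positivity)

end IsPlaneSolution

/-! ### From local to global convexity by energy-minimizing chains. -/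

section TietzeNakajima

variable {E : Type*} [NormedAddCommGroup E] {C : Set E}

/-- The `ε`-chains in `C` with `N` links from `x` to `y`, extended to the right by `y`. -/
def chainsBetween (C : Set E) (ε : ℝ) (N : ℕ) (x y : E) : Set (ℕ → E) :=
  {p | p 0 = x ∧ (∀ i, N ≤ i → p i = y) ∧ (∀ i, p i ∈ C) ∧ ∀ i, dist (p i) (p (i + 1)) ≤ ε}

theorem IsPreconnected.exists_chainsBetween_nonempty (hC : IsPreconnected C) {ε : ℝ} (hε : 0 < ε)
    {x y : E} (hx : x ∈ C) (hy : y ∈ C) : ∃ N, (chainsBetween C ε N x y).Nonempty := by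
  have h1 : Relation.ReflTransGen (fun a b => a ∈ C ∧ b ∈ C ∧ dist a b ≤ ε) x y := by
    refine hC.induction₂' _ (fun a ha => ?_) (fun _ _ _ _ _ _ => Relation.ReflTransGen.trans) hx hy
    filter_upwards [self_mem_nhdsWithin, mem_nhdsWithin_of_mem_nhds (Metric.ball_mem_nhds a hε)]
      with b hb hab
    rw [Metric.mem_ball] at hab
    exact ⟨.single ⟨ha, hb, by rw [dist_comm]; exact hab.le⟩, .single ⟨hb, ha, hab.le⟩⟩
  induction h1 using Relation.ReflTransGen.head_induction_on with
  | refl => exact ⟨0, fun _ => y, rfl, fun _ _ => rfl, fun _ => hy, fun _ => by simpa using hε.le⟩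
  | @head a c hac _ ih =>
    obtain ⟨N, p, hp0, hpN, hpC, hpd⟩ := ih hac.2.1
    refine ⟨N + 1, fun i => Nat.casesOn i a p, rfl, fun i hi => ?_, fun i => ?_, fun i => ?_⟩
    · cases i with
      | zero => omega
      | succ i => exact hpN i (by omega)
    · cases i with
      | zero => exact hx
      | succ i => exact hpC i
    · cases i with
      | zero => simpa [hp0] using hac.2.2
      | succ i => exact hpd i

/-- Tychonoff: the `i`-th vertex stays within `iε` of `x`, and all conditions are closed. -/
theorem isCompact_chainsBetween [ProperSpace E] (hC : IsClosed C) (ε : ℝ) (N : ℕ) (x y : E) :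
    IsCompact (chainsBetween C ε N x y) := by
  have hsub : chainsBetween C ε N x y ⊆ Set.univ.pi fun i : ℕ => Metric.closedBall x (i * ε) := by
    rintro p ⟨hp0, -, -, hpd⟩ i -
    induction i with
    | zero => simp [hp0]
    | succ i ih =>
      rw [Metric.mem_closedBall] at ih ⊢
      push_cast
      linarith [hpd i, dist_triangle (p (i + 1)) (p i) x, dist_comm (p i) (p (i + 1))]
  refine (isCompact_univ_pi fun i : ℕ => isCompact_closedBall x (i * ε)).of_isClosed_subset ?_ hsub
  have h1 : chainsBetween C ε N x y = {p | p 0 = x} ∩ ((⋂ i, {p | N ≤ i → p i = y}) ∩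
      ((⋂ i, {p | p i ∈ C}) ∩ ⋂ i, {p | dist (p i) (p (i + 1)) ≤ ε})) := by
    ext p; simp [chainsBetween]
  rw [h1]
  refine (isClosed_eq (by fun_prop) continuous_const).inter ((isClosed_iInter fun i => ?_).inter
    ((isClosed_iInter fun i => hC.preimage (continuous_apply i)).inter
      (isClosed_iInter fun i => isClosed_le (by fun_prop) continuous_const)))
  by_cases hi : N ≤ i
  · simpa [hi] using isClosed_eq (continuous_apply i) continuous_const
  · simp [hi]

variable [InnerProductSpace ℝ E] [ProperSpace E]

/-- A chain of minimal energy is an arithmetic progression. -/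
theorem exists_arithmetic_chain (hC : IsClosed C) (hconn : IsPreconnected C) {r : ℝ} (hr : 0 < r)
    (hloc : ∀ p ∈ C, Convex ℝ (C ∩ Metric.ball p r)) {x y : E} (hx : x ∈ C) (hy : y ∈ C) :
    ∃ (N : ℕ) (v : E), (∀ i ≤ N, x + (i : ℝ) • v ∈ C) ∧ ‖v‖ < r ∧ y = x + (N : ℝ) • v := by
  -- Both neighbours of a vertex then lie in its `r`-ball, where `C` is convex.
  set ε := r / 2 with hε
  have hεpos : 0 < ε := half_pos hr
  obtain ⟨N, hne⟩ := hconn.exists_chainsBetween_nonempty hεpos hx hy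
  obtain ⟨p, ⟨hp0, hpN, hpC, hpd⟩, hmin⟩ :=
    (isCompact_chainsBetween hC ε N x y).exists_isMinOn hne
      (f := fun p => ∑ i ∈ Finset.range N, dist (p i) (p (i + 1)) ^ 2) (by fun_prop)
  -- Replacing a vertex by the midpoint of its neighbours keeps the chain admissible and, by the
  -- parallelogram law, lowers the energy by twice the squared displacement.
  have hmid : ∀ k, k + 1 < N → p (k + 1) = midpoint ℝ (p k) (p (k + 2)) := by
    intro k hk
    set m := midpoint ℝ (p k) (p (k + 2)) with hm
    set q := Function.update p (k + 1) m with hq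
    have hqk : q (k + 1) = m := Function.update_self ..
    have hqne : ∀ i, i ≠ k + 1 → q i = p i := fun i hi => Function.update_of_ne hi ..
    have hd2 : dist (p k) (p (k + 2)) ≤ 2 * ε := by
      linarith [dist_triangle (p k) (p (k + 1)) (p (k + 2)), hpd k, hpd (k + 1)]
    have hdl : dist (p k) m = dist (p k) (p (k + 2)) / 2 := by
      rw [hm, dist_left_midpoint]; norm_num; ring
    have hdr : dist m (p (k + 2)) = dist (p k) (p (k + 2)) / 2 := by
      rw [hm, dist_midpoint_right]; norm_num; ring
    have hmC : m ∈ C := by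
      have h1 : p k ∈ C ∩ Metric.ball (p (k + 1)) r :=
        ⟨hpC k, by rw [Metric.mem_ball]; linarith [hpd k]⟩
      have h2 : p (k + 2) ∈ C ∩ Metric.ball (p (k + 1)) r :=
        ⟨hpC (k + 2), by rw [Metric.mem_ball, dist_comm]; linarith [hpd (k + 1)]⟩
      exact ((hloc _ (hpC (k + 1))).midpoint_mem h1 h2).1
    have hqmem : q ∈ chainsBetween C ε N x y := by
      refine ⟨by rw [hqne 0 (by omega), hp0], fun i hi => by rw [hqne i (by omega), hpN i hi],
        fun i => ?_, fun i => ?_⟩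
      · by_cases hi : i = k + 1
        · rw [hi, hqk]; exact hmC
        · rw [hqne i hi]; exact hpC i
      · by_cases hi : i = k + 1
        · rw [hi, hqk, hqne _ (by omega), hdr]; linarith
        by_cases hi' : i = k
        · rw [hi', hqk, hqne _ (by omega), hdl]; linarith
        · rw [hqne _ hi, hqne _ (by omega)]; exact hpd i
    have hle : ∑ i ∈ Finset.range N, dist (p i) (p (i + 1)) ^ 2 ≤
        ∑ i ∈ Finset.range N, dist (q i) (q (i + 1)) ^ 2 := hmin hqmem
    rw [← sub_nonpos, ← Finset.sum_sub_distrib,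
      Finset.sum_eq_add k (k + 1) (by omega)
      (fun c _ hc => by rw [hqne c hc.2, hqne (c + 1) (by omega), sub_self])
      (fun h => absurd (Finset.mem_range.2 (by omega)) h)
      (fun h => absurd (Finset.mem_range.2 (by omega)) h),
      hqk, hqne k (by omega), hqne (k + 1 + 1) (by omega)] at hle
    have hpar := EuclideanGeometry.dist_sq_add_dist_sq_eq_two_mul_dist_midpoint_sq_add_half_dist_sq
      (p (k + 1)) (p k) (p (k + 2))
    rw [← hm, dist_comm (p (k + 1)) (p k)] at hpar
    rw [show k + 1 + 1 = k + 2 by rfl, hdl, hdr] at hle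
    have h0 : dist (p (k + 1)) m ^ 2 ≤ 0 := by nlinarith
    exact dist_eq_zero.1 (pow_eq_zero_iff two_ne_zero |>.1 (le_antisymm h0 (sq_nonneg _)))
  set v := p 1 - p 0 with hv
  have hdiff : ∀ k, k < N → p (k + 1) - p k = v := by
    intro k
    induction k with
    | zero => intro _; rfl
    | succ k ih =>
      intro hk
      have h1 := hmid k hk
      have h2 := ih (by omega)
      rw [midpoint_eq_smul_add] at h1
      have h3 : p (k + 1) + p (k + 1) = p k + p (k + 2) := by
        rw [← two_smul ℝ (p (k + 1)), h1, smul_smul]; norm_num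
      rw [← h2, sub_eq_sub_iff_add_eq_add, show k + 1 + 1 = k + 2 by rfl, h3]
      abel
  have hprog : ∀ i, i ≤ N → p i = x + (i : ℝ) • v := by
    intro i
    induction i with
    | zero => intro _; simp [hp0]
    | succ i ih =>
      intro hi
      have h1 := hdiff i (by omega)
      rw [sub_eq_iff_eq_add.1 h1, ih (by omega)]
      push_cast
      module
  refine ⟨N, v, fun i hi => hprog i hi ▸ hpC i, ?_, (hpN N le_rfl).symm.trans (hprog N le_rfl)⟩
  have := hpd 0
  rw [dist_comm, dist_eq_norm] at this
  rw [hv]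
  linarith

/-- **Tietze–Nakajima theorem**: a closed connected set which is locally convex, uniformly, is
convex. -/
theorem convex_of_locally_convex (hC : IsClosed C) (hconn : IsPreconnected C) {r : ℝ} (hr : 0 < r)
    (hloc : ∀ p ∈ C, Convex ℝ (C ∩ Metric.ball p r)) : Convex ℝ C := by
  rw [convex_iff_segment_subset]
  intro x hx y hy z hz
  obtain ⟨N, v, hv, hvr, hyv⟩ := exists_arithmetic_chain hC hconn hr hloc hx hy
  rw [segment_eq_image'] at hz
  obtain ⟨s, hs, rfl⟩ := hz
  have h1 : x + s • (y - x) = x + (s * N) • v := by rw [hyv]; module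
  simp only [h1]
  have hsN0 : 0 ≤ s * N := mul_nonneg hs.1 (Nat.cast_nonneg N)
  have hsN : s * N ≤ N := mul_le_of_le_one_left (Nat.cast_nonneg N) hs.2
  -- The point lies between the consecutive vertices `k` and `k + 1`, or is the last vertex.
  set k := ⌊s * N⌋₊ with hk
  have hk1 : (k : ℝ) ≤ s * N := Nat.floor_le hsN0
  have hk2 : s * N < k + 1 := Nat.lt_floor_add_one _
  have hkN : k ≤ N := by exact_mod_cast hk1.trans hsN
  rcases hkN.eq_or_lt with h2 | h2
  · have : s * N = N := le_antisymm hsN (by rw [← h2] at hk1 ⊢; exact hk1)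
    rw [this]; exact hv N le_rfl
  · have h3 : x + (k : ℝ) • v ∈ C ∩ Metric.ball (x + (k : ℝ) • v) r :=
      ⟨hv k hkN, Metric.mem_ball_self hr⟩
    have h4 : x + ((k + 1 : ℕ) : ℝ) • v ∈ C ∩ Metric.ball (x + (k : ℝ) • v) r := by
      refine ⟨hv (k + 1) h2, ?_⟩
      rw [Metric.mem_ball, dist_eq_norm]
      have : x + ((k + 1 : ℕ) : ℝ) • v - (x + (k : ℝ) • v) = v := by push_cast; module
      rwa [this]
    have h5 := hloc _ (hv k hkN) h3 h4 (a := 1 - (s * N - k)) (b := s * N - k)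
      (by linarith) (by linarith) (by ring)
    have h6 : (1 - (s * N - k)) • (x + (k : ℝ) • v) + (s * N - k) • (x + ((k + 1 : ℕ) : ℝ) • v) =
        x + (s * N) • v := by push_cast; module
    rw [h6] at h5
    exact h5.1

end TietzeNakajima

/-! ### From positive curvature to strict convexity. -/

theorem HasPositiveBoundaryCurvatureAt.congr {C C' : Set Plane} {p : Plane}
    (h : HasPositiveBoundaryCurvatureAt C p) (hCC' : ∀ᶠ y in 𝓝 p, y ∈ C' ↔ y ∈ C) :
    HasPositiveBoundaryCurvatureAt C' p := by
  obtain ⟨φ, h1, h2, h3, h4, h5⟩ := h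
  refine ⟨φ, h1, h2, h3, ?_, h5⟩
  filter_upwards [h4, hCC'] with y h6 h7
  rw [h7, h6]

/-- If a chord touched the boundary at an inner point, `φ ≤ 0` along it would have a maximum there.
The chord would be tangent with nonpositive second derivative, against the curvature. -/
theorem Convex.strictConvex_of_hasPositiveBoundaryCurvatureAt {C : Set Plane} (hC : Convex ℝ C)
    (hcurv : ∀ p ∈ frontier C, HasPositiveBoundaryCurvatureAt C p) :
    StrictConvex ℝ C := by
  intro x hx y hy hxy a b ha hb hab
  by_contra hint
  set z := a • x + b • y with hz
  have hzC : z ∈ C := hC hx hy ha.le hb.le hab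
  obtain ⟨φ, hφ, hφ0, -, hmem, hpos⟩ := hcurv z ⟨subset_closure hzC, hint⟩
  have hline : ∀ᶠ t in 𝓝 (0 : ℝ), z + t • (y - x) ∈ C := by
    filter_upwards [gt_mem_nhds ha, lt_mem_nhds (neg_lt_zero.2 hb)] with t h1 h2
    have : z + t • (y - x) = (a - t) • x + (b + t) • y := by rw [hz]; module
    rw [this]
    exact hC hx hy (by linarith) (by linarith) (by linarith)
  have hmax : IsLocalMax (fun t : ℝ => φ (z + t • (y - x))) 0 := by
    filter_upwards [hline, (tendsto_line z (y - x)).eventually hmem] with t h1 h2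
    simpa [hφ0] using h2.1 h1
  obtain ⟨h1, h2⟩ := hφ.fderiv_fderiv_nonpos_of_isLocalMax_line hmax
  have h3 := hpos (y - x) (sub_ne_zero.2 hxy.symm) (by rw [inner_gradient_left, h1])
  rw [iteratedFDeriv_two_apply] at h3
  simp only [Matrix.cons_val_zero, Matrix.cons_val_one] at h3
  linarith

/-! ### Components of periodic, uniformly locally convex sets. -/

section Periodic

variable {Γ : AddSubgroup Plane} {Q E : Set Plane}

/-- Uniform local convexity of a periodic set. -/
theorem exists_uniform_convex_inter_ball (hQ : IsCompact Q) (hQΓ : ∀ x, ∃ ℓ ∈ Γ, x + ℓ ∈ Q)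
    (hE : ∀ ℓ ∈ Γ, ∀ x, x + ℓ ∈ E ↔ x ∈ E)
    (hloc : ∀ p, ∃ r > 0, Convex ℝ (E ∩ Metric.ball p r)) :
    ∃ r > 0, ∀ p, Convex ℝ (E ∩ Metric.ball p r) := by
  choose ρ hρ hconv using hloc
  obtain ⟨δ, hδ, hleb⟩ := lebesgue_number_lemma_of_metric hQ
    (c := fun p : Plane => Metric.ball p (ρ p)) (fun _ => Metric.isOpen_ball)
    (fun x _ => Set.mem_iUnion.2 ⟨x, Metric.mem_ball_self (hρ x)⟩)
  refine ⟨δ, hδ, fun p => ?_⟩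
  -- The Lebesgue number serves the points of `Q`; translation by a period carries it to every
  -- point.
  obtain ⟨ℓ, hℓ, hpQ⟩ := hQΓ p
  obtain ⟨c, hc⟩ := hleb _ hpQ
  have h1 : Convex ℝ (E ∩ Metric.ball (p + ℓ) δ) := by
    have h2 := (hconv c).inter (convex_ball (p + ℓ) δ)
    rwa [Set.inter_assoc, Set.inter_eq_right.2 hc] at h2
  have h3 : E ∩ Metric.ball p δ = (fun z => z + ℓ) ⁻¹' (E ∩ Metric.ball (p + ℓ) δ) := by
    ext z
    simp [hE ℓ hℓ]
  rw [h3]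
  exact h1.translate_preimage_left ℓ

variable {r : ℝ}

theorem inter_ball_subset_connectedComponentIn (hconv : ∀ p, Convex ℝ (E ∩ Metric.ball p r))
    (hr : 0 < r) {q p : Plane} (hp : p ∈ connectedComponentIn E q) :
    E ∩ Metric.ball p r ⊆ connectedComponentIn E q := by
  rw [connectedComponentIn_eq hp]
  exact (hconv p).isPreconnected.subset_connectedComponentIn
    ⟨connectedComponentIn_subset _ _ hp, Metric.mem_ball_self hr⟩ Set.inter_subset_left

/-- A limit point lies in `E` within `r` of the component, hence in the component: the uniform
radius is what matters. -/
theorem isClosed_connectedComponentIn (hcl : IsClosed E)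
    (hconv : ∀ p, Convex ℝ (E ∩ Metric.ball p r)) (hr : 0 < r) (q : Plane) :
    IsClosed (connectedComponentIn E q) := by
  refine isClosed_of_closure_subset fun x hx => ?_
  have hxE : x ∈ E := closure_minimal (connectedComponentIn_subset E q) hcl hx
  obtain ⟨p, hp, hpx⟩ := Metric.mem_closure_iff.1 hx r hr
  exact inter_ball_subset_connectedComponentIn hconv hr hp ⟨hxE, hpx⟩

theorem add_mem_connectedComponentIn (hE : ∀ ℓ ∈ Γ, ∀ x, x + ℓ ∈ E ↔ x ∈ E) {ℓ : Plane}
    (hℓ : ℓ ∈ Γ) {q x y : Plane} (hx : x ∈ connectedComponentIn E q)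
    (hxℓ : x + ℓ ∈ connectedComponentIn E q) (hy : y ∈ connectedComponentIn E q) :
    y + ℓ ∈ connectedComponentIn E q := by
  rw [connectedComponentIn_eq hxℓ]
  have h1 : IsPreconnected ((fun z => z + ℓ) '' connectedComponentIn E q) :=
    isPreconnected_connectedComponentIn.image _ (by fun_prop)
  refine h1.subset_connectedComponentIn ⟨x, hx, rfl⟩ ?_ ⟨y, hy, rfl⟩
  rintro _ ⟨z, hz, rfl⟩
  exact (hE ℓ hℓ z).2 (connectedComponentIn_subset _ _ hz)

/-- A strictly convex component of a periodic set is not invariant under any period. -/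
theorem eq_zero_of_add_mem_connectedComponentIn (hE : ∀ ℓ ∈ Γ, ∀ x, x + ℓ ∈ E ↔ x ∈ E)
    (hEne : E ≠ Set.univ) {q : Plane} (hcl : IsClosed (connectedComponentIn E q))
    (hstrict : StrictConvex ℝ (connectedComponentIn E q)) {x ℓ : Plane} (hℓ : ℓ ∈ Γ)
    (hx : x ∈ connectedComponentIn E q) (hxℓ : x + ℓ ∈ connectedComponentIn E q) : ℓ = 0 := by
  by_contra hne
  set C := connectedComponentIn E q with hC
  have hfr : (frontier C).Nonempty := by
    rw [nonempty_frontier_iff]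
    exact ⟨⟨x, hx⟩, fun h => hEne (Set.eq_univ_of_univ_subset
      (h ▸ connectedComponentIn_subset E q))⟩
  obtain ⟨p, hp⟩ := hfr
  have hpC : p ∈ C := hcl.frontier_subset hp
  -- The boundary point `p` becomes the midpoint of `p + ℓ` and `p - ℓ`, so strict convexity would
  -- place it in the interior.
  have h1 : p + ℓ ∈ C := add_mem_connectedComponentIn hE hℓ hx hxℓ hpC
  have h2 : p + -ℓ ∈ C := add_mem_connectedComponentIn hE (Γ.neg_mem hℓ) hxℓ
    (by simpa using hx) hpC
  have h3 := hstrict h1 h2 (fun h => hne (by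
    have h4 : ℓ = -ℓ := add_left_cancel h
    have h5 : (2 : ℝ) • ℓ = 0 := by
      rw [two_smul]; nth_rewrite 2 [h4]; exact add_neg_cancel ℓ
    exact (smul_eq_zero.1 h5).resolve_left two_ne_zero)) (a := 1 / 2) (b := 1 / 2) (by norm_num) (by norm_num) (by norm_num)
  have h4 : (1 / 2 : ℝ) • (p + ℓ) + (1 / 2 : ℝ) • (p + -ℓ) = p := by module
  rw [h4] at h3
  exact hp.2 h3

/-- A strictly convex set which does not meet its translates by the nonzero elements of a cocompact
group is bounded. -/
theorem StrictConvex.isBounded_of_cocompact {C : Set Plane} (hC : StrictConvex ℝ C)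
    (hQ : IsCompact Q) (hQΓ : ∀ x, ∃ ℓ ∈ Γ, x + ℓ ∈ Q)
    (hinj : ∀ x, ∀ ℓ ∈ Γ, x ∈ C → x + ℓ ∈ C → ℓ = 0) : Bornology.IsBounded C := by
  by_contra hunb
  obtain ⟨x, hx, y, hy, hxy⟩ : C.Nontrivial := by
    by_contra h
    exact hunb (Set.not_nontrivial_iff.1 h).finite.isBounded
  have hint := hC hx hy hxy (a := 1 / 2) (b := 1 / 2) (by norm_num) (by norm_num) (by norm_num)
  set z := (1 / 2 : ℝ) • x + (1 / 2 : ℝ) • y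
  obtain ⟨σ, hσ, hball⟩ := Metric.mem_nhds_iff.1 (mem_interior_iff_mem_nhds.1 hint)
  -- The bound `2s ≤ σ` makes balls of radius `s` fit along half of a long segment; `s ≤ 1` serves
  -- the final contradiction between unit-spaced points.
  set s := min (σ / 2) 1 with hs
  have hspos : 0 < s := by positivity
  have hsσ : 2 * s ≤ σ := by linarith [min_le_left (σ / 2) 1]
  have hs1 : s ≤ 1 := min_le_right _ _
  obtain ⟨T, hT, hcover⟩ := Metric.totallyBounded_iff.1 hQ.totallyBounded (s / 2) (half_pos hspos)
  set K := hT.toFinset.card with hK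
  obtain ⟨w, hw, hwd⟩ : ∃ w ∈ C, 2 * (K + 1 : ℝ) ≤ dist w z := by
    by_contra! h
    exact hunb (Metric.isBounded_closedBall.subset fun w hw => (h w hw).le)
  set L := dist w z with hL
  have hLpos : 0 < L := lt_of_lt_of_le (by positivity) hwd
  set e : Plane := L⁻¹ • (w - z) with he
  have henorm : ‖e‖ = 1 := by
    rw [he, norm_smul, ← dist_eq_norm, ← hL, norm_inv, Real.norm_of_nonneg hLpos.le,
      inv_mul_cancel₀ hLpos.ne']
  -- The convex hull of a ball about `z` and the point `w` tapers linearly, and `|w - z| ≥ 2(K + 1)`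
  -- keeps at least half of the radius up to distance `K`.
  have hthick : ∀ t : ℝ, 0 ≤ t → t ≤ K → Metric.ball (z + t • e) s ⊆ C := by
    intro t ht0 htK u hu
    set c := t / L with hc
    have hc0 : 0 ≤ c := by positivity
    have hc1 : c ≤ 1 / 2 := by rw [hc, div_le_iff₀ hLpos]; linarith
    set u' := z + (1 - c)⁻¹ • (u - (z + t • e)) with hu'
    have h1c : 0 < 1 - c := by linarith
    have hu'C : u' ∈ C := by
      apply hball
      rw [Metric.mem_ball, dist_eq_norm] at hu
      rw [Metric.mem_ball, dist_eq_norm, hu', add_sub_cancel_left, norm_smul, norm_inv,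
        Real.norm_of_nonneg h1c.le, inv_mul_lt_iff₀ h1c]
      nlinarith
    have h2 := hC.convex hu'C hw h1c.le hc0 (by ring)
    have h3 : (1 - c) • u' + c • w = u := by
      have h4 : t • e = c • (w - z) := by rw [he, smul_smul, hc, div_eq_mul_inv]
      rw [hu', smul_add, smul_smul, mul_inv_cancel₀ h1c.ne', h4]
      module
    rwa [h3] at h2
  choose τ hτ hτQ using hQΓ
  have hmemT : ∀ k : ℕ, ∃ c ∈ T, (z + (k : ℝ) • e) + τ (z + (k : ℝ) • e) ∈ Metric.ball c (s / 2) :=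
    fun k => by simpa using hcover (hτQ (z + (k : ℝ) • e))
  choose c hcT hcb using hmemT
  -- Pigeonhole: `K + 1` points of the segment, reduced to `Q`, fall into `K` small balls.
  obtain ⟨i, hi, j, hj, hij, hcij⟩ := Finset.exists_ne_map_eq_of_card_lt_of_maps_to
    (s := Finset.range (K + 1)) (t := hT.toFinset) (f := c) (by rw [Finset.card_range]; omega)
    (fun k _ => by simpa using hcT k)
  have hiK : (i : ℝ) ≤ K := by
    exact_mod_cast Nat.lt_succ_iff.1 (Finset.mem_range.1 hi)
  have hjK : (j : ℝ) ≤ K := by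
    exact_mod_cast Nat.lt_succ_iff.1 (Finset.mem_range.1 hj)
  set wi := z + (i : ℝ) • e with hwi
  set wj := z + (j : ℝ) • e with hwj
  have hdist : dist (wi + τ wi) (wj + τ wj) < s := by
    have h1 := hcb i
    have h2 := hcb j
    rw [← hcij] at h2
    rw [Metric.mem_ball] at h1 h2
    linarith [dist_triangle_right (wi + τ wi) (wj + τ wj) (c i)]
  have hd2 : dist (wi + (τ wi - τ wj)) wj < s := by
    rw [dist_eq_norm] at hdist ⊢
    rwa [show wi + (τ wi - τ wj) - wj = wi + τ wi - (wj + τ wj) by abel]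
  -- The translate of `wi` falls in the ball about `wj`, hence in `C`; so the period vanishes and
  -- `wi`, `wj` are less than `s ≤ 1` apart.
  have hzero := hinj wi (τ wi - τ wj) (Γ.sub_mem (hτ _) (hτ _))
    (hthick i (Nat.cast_nonneg i) hiK (Metric.mem_ball_self hspos))
    (hthick j (Nat.cast_nonneg j) hjK hd2)
  rw [hzero, add_zero, dist_eq_norm, hwi, hwj,
    show z + (i : ℝ) • e - (z + (j : ℝ) • e) = ((i : ℝ) - j) • e by module, norm_smul, henorm,
    mul_one] at hd2
  have h1 : (1 : ℝ) ≤ ‖(i : ℝ) - j‖ := by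
    have h2 : (1 : ℤ) ≤ |(i : ℤ) - j| := Int.one_le_abs (by omega)
    rw [Real.norm_eq_abs]
    exact_mod_cast h2
  linarith

end Periodic

/-! ### The covering of the torus by the plane. -/

section Torus

variable {v₁ v₂ : Plane}

theorem continuous_torusProj : Continuous (torusProj v₁ v₂) := QuotientAddGroup.continuous_mk

theorem isOpenMap_torusProj : IsOpenMap (torusProj v₁ v₂) := QuotientAddGroup.isOpenMap_coe

theorem surjective_torusProj : Function.Surjective (torusProj v₁ v₂) :=
  QuotientAddGroup.mk_surjective

theorem torusProj_eq_iff {x y : Plane} :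
    torusProj v₁ v₂ x = torusProj v₁ v₂ y ↔ ∃ ℓ ∈ planeLattice v₁ v₂, y = x + ℓ := by
  rw [torusProj, torusProj, QuotientAddGroup.eq]
  constructor
  · exact fun h => ⟨_, h, by abel⟩
  · rintro ⟨ℓ, hℓ, rfl⟩
    simpa using hℓ

theorem torusProj_add {x ℓ : Plane} (hℓ : ℓ ∈ planeLattice v₁ v₂) :
    torusProj v₁ v₂ (x + ℓ) = torusProj v₁ v₂ x :=
  (torusProj_eq_iff.2 ⟨ℓ, hℓ, rfl⟩).symm

theorem closure_preimage_torusProj (Ω : Set (FlatTorus v₁ v₂)) :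
    closure (torusProj v₁ v₂ ⁻¹' Ω) = torusProj v₁ v₂ ⁻¹' closure Ω :=
  (isOpenMap_torusProj.preimage_closure_eq_closure_preimage continuous_torusProj Ω).symm

theorem frontier_preimage_torusProj (Ω : Set (FlatTorus v₁ v₂)) :
    frontier (torusProj v₁ v₂ ⁻¹' Ω) = torusProj v₁ v₂ ⁻¹' frontier Ω :=
  (isOpenMap_torusProj.preimage_frontier_eq_frontier_preimage continuous_torusProj Ω).symm

theorem exists_isCompact_planeLattice (hv : LinearIndependent ℝ ![v₁, v₂]) :
    ∃ Q : Set Plane, IsCompact Q ∧ ∀ x, ∃ ℓ ∈ planeLattice v₁ v₂, x + ℓ ∈ Q := by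
  refine ⟨(fun s : ℝ × ℝ => s.1 • v₁ + s.2 • v₂) '' (Set.Icc 0 1 ×ˢ Set.Icc 0 1),
    (isCompact_Icc.prod isCompact_Icc).image (by fun_prop), fun x => ?_⟩
  have hx : x ∈ Submodule.span ℝ (Set.range ![v₁, v₂]) := by
    rw [hv.span_eq_top_of_card_eq_finrank (by simp)]
    trivial
  rw [Matrix.range_cons, Matrix.range_cons, Matrix.range_empty, Set.union_empty,
    Set.singleton_union, Submodule.mem_span_pair] at hx
  obtain ⟨a, b, rfl⟩ := hx
  have h1 : v₁ ∈ planeLattice v₁ v₂ := AddSubgroup.subset_closure (by simp)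
  have h2 : v₂ ∈ planeLattice v₁ v₂ := AddSubgroup.subset_closure (by simp)
  refine ⟨(-⌊a⌋) • v₁ + (-⌊b⌋) • v₂, add_mem (zsmul_mem h1 _) (zsmul_mem h2 _),
    (Int.fract a, Int.fract b), ⟨⟨Int.fract_nonneg a, (Int.fract_lt_one a).le⟩,
      ⟨Int.fract_nonneg b, (Int.fract_lt_one b).le⟩⟩, ?_⟩
  simp only [Int.fract, ← Int.cast_smul_eq_zsmul ℝ]
  push_cast
  module

/-- A set whose membership is locally constant along a preconnected set `s` contains `s` as soon as
it meets it; the local condition is tested on lifts to the plane. -/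
theorem mem_of_isPreconnected_of_lift {s A : Set (FlatTorus v₁ v₂)} (hs : IsPreconnected s)
    (h : ∀ x, torusProj v₁ v₂ x ∈ s → ∀ᶠ y in 𝓝 x, torusProj v₁ v₂ y ∈ s →
      (torusProj v₁ v₂ y ∈ A ↔ torusProj v₁ v₂ x ∈ A))
    {a b : FlatTorus v₁ v₂} (ha : a ∈ s) (hb : b ∈ s) (haA : a ∈ A) : b ∈ A := by
  refine hs.induction₂' (fun a b => a ∈ A → b ∈ A) (fun a ha => ?_)
    (fun _ _ _ _ _ _ h1 h2 h3 => h2 (h1 h3)) ha hb haA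
  obtain ⟨x, rfl⟩ := surjective_torusProj a
  have h1 := isOpenMap_torusProj.nhds_le x (Filter.eventually_map.2 (h x ha) :
    ∀ᶠ b in Filter.map (torusProj v₁ v₂) (𝓝 x), b ∈ s → (b ∈ A ↔ torusProj v₁ v₂ x ∈ A))
  rw [eventually_nhdsWithin_iff]
  filter_upwards [h1] with b hb hbs
  exact ⟨(hb hbs).2, (hb hbs).1⟩

end Torus

/-! ### The problem on the torus and the bound on its `P`-function. -/

theorem continuous_extend_Ici {f : ℝ → ℝ} (hf : ContinuousOn f (Set.Ici 0)) :
    Continuous fun s => f (max s 0) :=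
  hf.comp_continuous (by fun_prop) fun s => le_max_right s 0

namespace IsOverdeterminedSolution

variable {v₁ v₂ : Plane} {Ω : Set (FlatTorus v₁ v₂)} {f : ℝ → ℝ} {α : ℝ}
  {u : FlatTorus v₁ v₂ → ℝ}

/-- Replacing `f(s)` by `f(max s 0)` gives a continuous function with a primitive on the whole line,
still `C¹` at the positive values taken by `u` in `Ω`. -/
theorem isPlaneSolution (hu : IsOverdeterminedSolution Ω f α u) (hΩ : IsOpen Ω)
    (hbdry : HasC1Boundary (torusProj v₁ v₂ ⁻¹' Ω)) (hf : ContDiffOn ℝ 1 f (Set.Ici 0)) :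
    IsPlaneSolution (torusProj v₁ v₂ ⁻¹' Ω) (fun s => f (max s 0))
      (fun s => ∫ t in (0 : ℝ)..s, f (max t 0)) α (u ∘ torusProj v₁ v₂) where
  isOpen := hΩ.preimage continuous_torusProj
  hasC1Boundary := hbdry
  contDiffOn_closure := by
    rw [closure_preimage_torusProj]; exact hu.contDiffOn_closure
  contDiffOn := hu.contDiffOn_interior
  continuous_f := continuous_extend_Ici hf.continuousOn
  contDiffAt_f x hx := by
    have hpos := hu.pos _ hx
    refine (hf.contDiffAt (Ici_mem_nhds hpos)).congr_of_eventuallyEq ?_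
    filter_upwards [lt_mem_nhds hpos] with s hs
    rw [max_eq_left hs.le]
  hasDerivAt_F s :=
    ((continuous_extend_Ici hf.continuousOn).integral_hasStrictDerivAt 0 s).hasDerivAt
  F_zero := intervalIntegral.integral_same
  equation x hx := by
    have := hu.equation x hx
    simpa only [Function.comp_apply, max_eq_left (hu.pos _ hx).le] using this
  pos x hx := hu.pos _ hx
  dirichlet x hx := by
    rw [frontier_preimage_torusProj] at hx
    exact hu.dirichlet _ hx
  neumann x hx ν hν := by
    rw [frontier_preimage_torusProj] at hx
    rw [closure_preimage_torusProj, ← inner_gradientWithin_left]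
    exact hu.neumann x hx ν hν

/-- The `P`-function is everywhere smaller than its boundary value `α²`. -/
theorem pFunction_lt (hu : IsOverdeterminedSolution Ω f α u) (hv : LinearIndependent ℝ ![v₁, v₂])
    (hΩ : IsOpen Ω) (hconn : IsPreconnected Ω)
    (hbdry : HasC1Boundary (torusProj v₁ v₂ ⁻¹' Ω)) (hf : ContDiffOn ℝ 1 f (Set.Ici 0))
    (hmax : ∀ q ∈ closure Ω, 2 * (∫ s in (0 : ℝ)..(u q), f s) < α ^ 2) (hα : α ≠ 0)
    {x : Plane} (hx : torusProj v₁ v₂ x ∈ Ω) :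
    pFunction (fun s => ∫ t in (0 : ℝ)..s, f (max t 0)) (u ∘ torusProj v₁ v₂)
      (fderivWithin ℝ (u ∘ torusProj v₁ v₂) (closure (torusProj v₁ v₂ ⁻¹' Ω))) x < α ^ 2 := by
  set F : ℝ → ℝ := fun s => ∫ t in (0 : ℝ)..s, f (max t 0) with hF
  set π := torusProj v₁ v₂ with hπ
  set U := u ∘ π with hU
  set D := π ⁻¹' Ω with hD
  set G := fderivWithin ℝ U (closure D) with hG
  set P := pFunction F U G with hP
  have h : IsPlaneSolution D (fun s => f (max s 0)) F α U := hu.isPlaneSolution hΩ hbdry hf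
  have hFmax : ∀ y ∈ D, 2 * F (U y) < α ^ 2 := fun y hy => by
    have h1 := hmax (π y) (subset_closure hy)
    have h2 : F (U y) = ∫ s in (0 : ℝ)..(u (π y)), f s := by
      refine intervalIntegral.integral_congr fun s hs => ?_
      rw [Set.uIcc_of_le (h.pos y hy).le] at hs
      simp only [max_eq_left hs.1]
    rwa [h2]
  have hGne : ∀ y ∈ D, α ^ 2 ≤ P y → G y ≠ 0 := fun y hy hPy h0 => by
    have h1 := hFmax y hy
    rw [hP, pFunction, h0, norm_zero] at hPy
    linarith
  have hDper : ∀ ℓ ∈ planeLattice v₁ v₂, ∀ y, y + ℓ ∈ D ↔ y ∈ D := fun ℓ hℓ y => by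
    rw [hD, Set.mem_preimage, Set.mem_preimage, hπ, torusProj_add hℓ]
  have hUper : ∀ ℓ ∈ planeLattice v₁ v₂, ∀ y, U (y + ℓ) = U y := fun ℓ hℓ y => by
    simp only [hU, Function.comp_apply, hπ, torusProj_add hℓ]
  have hGD : ∀ y ∈ D, G y = fderiv ℝ U y := fun y hy =>
    (h.fderivWithin_eventuallyEq hy).self_of_nhds
  have hPper : ∀ ℓ ∈ planeLattice v₁ v₂, ∀ y ∈ D, P (y + ℓ) = P y := fun ℓ hℓ y hy => by
    have h1 : fderiv ℝ U (y + ℓ) = fderiv ℝ U y := by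
      rw [← fderiv_comp_add_right]
      congr 1
      ext1 z
      exact hUper ℓ hℓ z
    simp only [hP, pFunction]
    rw [hGD _ ((hDper ℓ hℓ y).2 hy), hGD y hy, h1, hUper ℓ hℓ]
  obtain ⟨Q, hQ, hQΓ⟩ := exists_isCompact_planeLattice hv
  have hDQ : (closure D ∩ Q).Nonempty := by
    obtain ⟨ℓ, hℓ, hxQ⟩ := hQΓ x
    exact ⟨x + ℓ, subset_closure ((hDper ℓ hℓ x).2 hx), hxQ⟩
  have hcpt : IsCompact (closure D ∩ Q) := hQ.inter_left isClosed_closure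
  obtain ⟨x₁, hx₁, hx₁max⟩ := hcpt.exists_isMaxOn hDQ
    (h.continuousOn_pFunction.mono Set.inter_subset_left)
  have hPle : ∀ y ∈ D, P y ≤ P x₁ := fun y hy => by
    obtain ⟨ℓ, hℓ, hyQ⟩ := hQΓ y
    rw [← hPper ℓ hℓ y hy]
    exact hx₁max ⟨subset_closure ((hDper ℓ hℓ y).2 hy), hyQ⟩
  by_contra! hcon
  have hMα : α ^ 2 ≤ P x₁ := hcon.trans (hPle x hx)
  -- If the maximum sits on the boundary it equals `α² ≤ P x`, so `x` itself is an interior maximum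
  -- point.
  obtain ⟨x₂, hx₂, hx₂M⟩ : ∃ y ∈ D, P y = P x₁ := by
    have h1 := hx₁.1
    rw [closure_eq_self_union_frontier] at h1
    rcases h1 with h1 | h1
    · exact ⟨x₁, h1, rfl⟩
    · exact ⟨x, hx, le_antisymm (hPle x hx)
        ((h.pFunction_eq_of_mem_frontier hα h1).trans_le hcon)⟩
  have hmemA : ∀ y ∈ D, (π y ∈ π '' {z | z ∈ D ∧ P z = P x₁} ↔ P y = P x₁) := fun y hy => by
    constructor
    · rintro ⟨z, ⟨hz, hzP⟩, hzy⟩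
      obtain ⟨ℓ, hℓ, rfl⟩ := torusProj_eq_iff.1 hzy
      rw [hPper ℓ hℓ z hz, hzP]
    · exact fun hyP => ⟨y, ⟨hy, hyP⟩, rfl⟩
  -- The preimage `D` need not be connected, so the open-closed argument runs in `Ω`, to which the
  -- periodic contact set descends. Contact points are noncritical because the maximum is at least
  -- `α²`.
  have hall : ∀ y ∈ D, P y = P x₁ := fun y hy => by
    rw [← hmemA y hy]
    refine mem_of_isPreconnected_of_lift hconn (fun z hz => ?_) hx₂ hy ((hmemA x₂ hx₂).2 hx₂M)
    by_cases hzP : P z = P x₁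
    · filter_upwards [h.eventually_pFunction_eq hPle hz hzP (hGne z hz (hzP ▸ hMα))] with w hw hwD
      exact iff_of_true ((hmemA w hwD).2 hw) ((hmemA z hz).2 hzP)
    · have hcont : ContinuousAt P z := (h.contDiffAt_pFunction hz).continuousAt
      filter_upwards [hcont.eventually_ne hzP] with w hw hwD
      exact iff_of_false (mt (hmemA w hwD).1 hw) (mt (hmemA z hz).1 hzP)
  -- A maximum of `u` is interior, since `u` is positive inside and zero on the boundary; there `∇u
  -- = 0`, although `P ≥ α²` excludes critical points.
  obtain ⟨x₃, hx₃, hx₃max⟩ := hcpt.exists_isMaxOn hDQ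
    (h.contDiffOn_closure.continuousOn.mono Set.inter_subset_left)
  have hUle : ∀ y ∈ D, U y ≤ U x₃ := fun y hy => by
    obtain ⟨ℓ, hℓ, hyQ⟩ := hQΓ y
    rw [← hUper ℓ hℓ y]
    exact hx₃max ⟨subset_closure ((hDper ℓ hℓ y).2 hy), hyQ⟩
  have hx₃D : x₃ ∈ D := by
    have h1 := hx₃.1
    rw [closure_eq_self_union_frontier] at h1
    refine h1.resolve_right fun h2 => ?_
    have h3 := hUle x hx
    rw [h.dirichlet x₃ h2] at h3
    exact absurd (h.pos x hx) h3.not_gt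
  refine hGne x₃ hx₃D (by rw [hall x₃ hx₃D]; exact hMα) ?_
  have hloc : IsLocalMax U x₃ := by
    filter_upwards [h.isOpen.mem_nhds hx₃D] with y hy using hUle y hy
  rw [hGD x₃ hx₃D, hloc.fderiv_eq_zero]

end IsOverdeterminedSolution

/-- A closed subset of the flat torus, not the whole torus, whose boundary has positive curvature
has strictly convex components. -/
theorem isStrictlyConvexRegion_connectedComponentIn {v₁ v₂ : Plane}
    (hv : LinearIndependent ℝ ![v₁, v₂]) {S : Set (FlatTorus v₁ v₂)} (hS : IsClosed S)
    (hSne : S ≠ Set.univ)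
    (hcurv : ∀ p ∈ frontier (torusProj v₁ v₂ ⁻¹' S),
      HasPositiveBoundaryCurvatureAt (torusProj v₁ v₂ ⁻¹' S) p)
    (hloc : ∀ p ∈ frontier (torusProj v₁ v₂ ⁻¹' S), ∃ r > 0,
      Convex ℝ (torusProj v₁ v₂ ⁻¹' S ∩ Metric.ball p r))
    {q : FlatTorus v₁ v₂} (hq : q ∈ S) : IsStrictlyConvexRegion (connectedComponentIn S q) := by
  set π := torusProj v₁ v₂ with hπ
  set E := π ⁻¹' S with hE
  have hEcl : IsClosed E := hS.preimage continuous_torusProj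
  have hEne : E ≠ Set.univ := fun h => hSne <| Set.eq_univ_of_forall fun a => by
    obtain ⟨x, rfl⟩ := surjective_torusProj a
    exact (h ▸ Set.mem_univ x : x ∈ E)
  have hEper : ∀ ℓ ∈ planeLattice v₁ v₂, ∀ x, x + ℓ ∈ E ↔ x ∈ E := fun ℓ hℓ x => by
    rw [hE, Set.mem_preimage, Set.mem_preimage, hπ, torusProj_add hℓ]
  obtain ⟨Q, hQ, hQΓ⟩ := exists_isCompact_planeLattice hv
  obtain ⟨r, hr, hconv⟩ : ∃ r > 0, ∀ p, Convex ℝ (E ∩ Metric.ball p r) := by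
    refine exists_uniform_convex_inter_ball hQ hQΓ hEper fun p => ?_
    by_cases hp : p ∈ frontier E
    · exact hloc p hp
    by_cases hpE : p ∈ E
    · have h1 : E ∈ 𝓝 p := by
        rw [← mem_interior_iff_mem_nhds]
        by_contra h2
        exact hp ⟨subset_closure hpE, h2⟩
      obtain ⟨r, hr, hball⟩ := Metric.mem_nhds_iff.1 h1
      exact ⟨r, hr, by rw [Set.inter_eq_right.2 hball]; exact convex_ball p r⟩
    · obtain ⟨r, hr, hball⟩ := Metric.mem_nhds_iff.1 (hEcl.isOpen_compl.mem_nhds hpE)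
      refine ⟨r, hr, ?_⟩
      have : E ∩ Metric.ball p r = ∅ :=
        Set.disjoint_iff_inter_eq_empty.1 (Set.subset_compl_iff_disjoint_left.1 hball)
      rw [this]; exact convex_empty
  obtain ⟨x₀, rfl⟩ := surjective_torusProj q
  set C := connectedComponentIn E x₀ with hC
  have hCE : C ⊆ E := connectedComponentIn_subset E x₀
  have hCball : ∀ p ∈ C, E ∩ Metric.ball p r ⊆ C := fun p hp =>
    inter_ball_subset_connectedComponentIn hconv hr hp
  have hCloc : ∀ p ∈ C, ∀ᶠ y in 𝓝 p, y ∈ C ↔ y ∈ E := fun p hp => by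
    filter_upwards [Metric.ball_mem_nhds p hr] with y hy
    exact ⟨fun h => hCE h, fun h => hCball p hp ⟨h, hy⟩⟩
  have hCcl : IsClosed C := isClosed_connectedComponentIn hEcl hconv hr x₀
  have hCconvex : Convex ℝ C := by
    refine convex_of_locally_convex hCcl isPreconnected_connectedComponentIn hr fun p hp => ?_
    have : C ∩ Metric.ball p r = E ∩ Metric.ball p r := by
      ext y
      exact ⟨fun h => ⟨hCE h.1, h.2⟩, fun h => ⟨hCball p hp h, h.2⟩⟩
    rw [this]
    exact hconv p
  have hCcurv : ∀ p ∈ frontier C, HasPositiveBoundaryCurvatureAt C p := fun p hp => by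
    have hpC : p ∈ C := hCcl.frontier_subset hp
    refine (hcurv p ⟨subset_closure (hCE hpC), fun hint => hp.2 ?_⟩).congr (hCloc p hpC)
    rw [mem_interior_iff_mem_nhds] at hint ⊢
    filter_upwards [hCloc p hpC, hint] with y h1 h2 using h1.2 h2
  have hCstrict : StrictConvex ℝ C := hCconvex.strictConvex_of_hasPositiveBoundaryCurvatureAt hCcurv
  have hinj : ∀ x, ∀ ℓ ∈ planeLattice v₁ v₂, x ∈ C → x + ℓ ∈ C → ℓ = 0 := fun x ℓ hℓ hx hxℓ =>
    eq_zero_of_add_mem_connectedComponentIn hEper hEne hCcl hCstrict hℓ hx hxℓ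
  refine ⟨C, Metric.isCompact_of_isClosed_isBounded hCcl
    (hCstrict.isBounded_of_cocompact hQ hQΓ hinj), hCstrict, hCcurv, ?_, ?_⟩
  · intro x hx y hy hxy
    obtain ⟨ℓ, hℓ, rfl⟩ := torusProj_eq_iff.1 hxy
    rw [hinj x ℓ hℓ hx hy, add_zero]
  have hx₀C : x₀ ∈ C := mem_connectedComponentIn hq
  refine Set.Subset.antisymm ?_ ?_
  · refine IsPreconnected.subset_connectedComponentIn
      (isPreconnected_connectedComponentIn.image _ continuous_torusProj.continuousOn)
      ⟨x₀, hx₀C, rfl⟩ ?_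
    rintro _ ⟨x, hx, rfl⟩
    exact hCE hx
  · intro b hb
    -- Being in the image of `C` is locally constant, at the uniform scale `r`, along the
    -- complement; hence `C` covers the whole component.
    have hmem : ∀ z w : Plane, w ∈ E → dist w z < r → π z ∈ π '' C → π w ∈ π '' C := by
      rintro z w hw hwz ⟨c, hc, hcz⟩
      obtain ⟨ℓ, hℓ, rfl⟩ := torusProj_eq_iff.1 hcz
      refine ⟨w + -ℓ, hCball c hc ⟨(hEper _ (neg_mem hℓ) w).2 hw, ?_⟩, torusProj_add (neg_mem hℓ)⟩
      rw [dist_eq_norm] at hwz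
      rw [Metric.mem_ball, dist_eq_norm]
      rwa [show w + -ℓ - c = w - (c + ℓ) by abel]
    refine mem_of_isPreconnected_of_lift (s := connectedComponentIn S (π x₀)) (A := π '' C)
      isPreconnected_connectedComponentIn (fun z hz => ?_) (mem_connectedComponentIn hq) hb
      ⟨x₀, hx₀C, rfl⟩
    filter_upwards [Metric.ball_mem_nhds z hr] with w hw hwK
    have hzE : z ∈ E := connectedComponentIn_subset S _ hz
    have hwE : w ∈ E := connectedComponentIn_subset S _ hwK
    exact ⟨hmem w z hzE (by rw [dist_comm]; exact hw), hmem z w hwE hw⟩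

end

theorem theorem2p12 (v₁ v₂ : Plane) (hv : LinearIndependent ℝ ![v₁, v₂])
    (Ω : Set (FlatTorus v₁ v₂)) (hΩ_open : IsOpen Ω) (hΩ_conn : IsConnected Ω)
    (hΩ_bdry : HasC1Boundary (torusProj v₁ v₂ ⁻¹' Ω))
    (f : ℝ → ℝ) (hf : ContDiffOn ℝ 1 f (Set.Ici 0)) (α : ℝ)
    (u : FlatTorus v₁ v₂ → ℝ) (hu : IsOverdeterminedSolution Ω f α u)
    (hmax : ∀ q ∈ closure Ω, 2 * (∫ s in (0 : ℝ)..(u q), f s) < α ^ 2) :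
    ∀ q ∈ Ωᶜ, IsStrictlyConvexRegion (connectedComponentIn Ωᶜ q) := by
  intro q hq
  obtain ⟨q₀, hq₀⟩ := hΩ_conn.nonempty
  have hpre : PreconnectedSpace (FlatTorus v₁ v₂) :=
    (Function.Surjective.denseRange surjective_torusProj).preconnectedSpace
      (continuous_torusProj (v₁ := v₁) (v₂ := v₂))
  -- The torus is connected and both `Ω` and its complement are nonempty, so there is a boundary
  -- point; there `u = 0` and the hypothesis reads `0 < α²`.
  have hα : α ≠ 0 := by
    obtain ⟨p, hp⟩ : (frontier Ω).Nonempty :=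
      nonempty_frontier_iff.2 ⟨⟨q₀, hq₀⟩, fun h => hq (h ▸ Set.mem_univ q)⟩
    have h1 := hmax p (frontier_subset_closure hp)
    rw [hu.dirichlet p hp, intervalIntegral.integral_same, mul_zero] at h1
    rintro rfl
    simp at h1
  have h := hu.isPlaneSolution hΩ_open hΩ_bdry hf
  have key : ∀ p ∈ frontier (torusProj v₁ v₂ ⁻¹' Ωᶜ), ∃ b g,
      IsSubgraphNear 2 (torusProj v₁ v₂ ⁻¹' Ω) p b g ∧ 0 < deriv (deriv g) 0 := fun p hp => by
    rw [Set.preimage_compl, frontier_compl] at hp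
    exact h.exists_isSubgraphNear_deriv_pos hα (fun x hx =>
      hu.pFunction_lt hv hΩ_open hΩ_conn.isPreconnected hΩ_bdry hf hmax hα hx) hp
  refine isStrictlyConvexRegion_connectedComponentIn hv hΩ_open.isClosed_compl
    (fun h => (h ▸ Set.mem_univ q₀ : q₀ ∈ Ωᶜ) hq₀) (fun p hp => ?_) (fun p hp => ?_) hq
  · obtain ⟨b, g, hg, hpos⟩ := key p hp
    exact hg.hasPositiveBoundaryCurvatureAt_compl hpos
  · obtain ⟨b, g, hg, hpos⟩ := key p hp
    exact hg.exists_convex_compl_inter_ball hpos
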